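/- Let $G$ be a locally compact second countable group with a left Haar measure $\mu$ and modular function $\Delta$ (so $\mu(Eg)=\Delta(g)\mu(E)$), equipped with a proper left-invariant metric $d$ inducing its topology. Let $Z\subseteq G$ be a uniformly locally finite metric lattice: $Z$ is uniformly discrete, the closed balls of some fixed radius centred at points of $Z$ cover $G$, and for every $S>0$ the balls of radius $S$ in $Z$ have uniformly bounded finite cardinality. Let $C^*_u(Z)\subseteq B(\ell^2(Z))$ be the uniform Roe algebra, i.e. the norm closure of the bounded operators $a=[a_{x,y}]$ of finite propagation, and let $G^*(Z)$ be its ghost ideal, consisting of all $a\in C_u^*(Z)$ with $a_{x,y}\to 0$ as $x,y\to\infty$. Let $C_b^{ru}(G)$ be the $C^*$-algebra of bounded continuous functions $f$ on $G$ with $\|R_gf-f\|_\infty\to0$ as $g\to e$, where $(R_gf)(x)=f(xg)$, and let $G$ act by $R$ on $C_b^{ru}(G)$ and on the quotient $C_b^{ru}(G)/C_0(G)$. Form the reduced crossed products $C_b^{ru}(G)\rtimes_{R,r}G$ and $(C_b^{ru}(G)/C_0(G))\rtimes_{R,r}G$ (using any faithful $*$-representations of the two coefficient algebras on Hilbert spaces).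 On $L^2(G)$ let $M(f)\xi=f\xi$ and $(\rho_g\xi)(x)=\xi(xg)\Delta(g)^{1/2}$. Choose $\delta>0$ with $d(z,w)\ge\delta$ for all distinct $z,w\in Z$ and a continuous, compactly supported $\varphi\ge 0$ on $G$ with $\operatorname{supp}\varphi\subseteq B(e,\delta/4)$ (closed ball) and $\|\varphi\|_2=1$, and let $W:\ell^2(Z)\to L^2(G)$ be the linear isometry with $W\delta_z=\varphi_z$, $\varphi_z(x)=\varphi(z^{-1}x)$. Then: 1. the integrated form $f\mapsto\int_G M(f(s))\rho_s\,d\mu(s)$ on $C_c(G,C_b^{ru}(G))$ extends to a faithful $*$-representation $M\rtimes_r\rho$ of $C_b^{ru}(G)\rtimes_{R,r}G$ on $L^2(G)$; 2. $\Phi(T)=(M\rtimes_r\rho)^{-1}(WTW^*)$ is a well-defined faithful $*$-homomorphism $\Phi:C_u^*(Z)\to C_b^{ru}(G)\rtimes_{R,r}G$; 3. the quotient map $C_b^{ru}(G)\to C_b^{ru}(G)/C_0(G)$ induces, via $f\mapsto (s\mapsto f(s)+C_0(G))$ on $C_c(G,C_b^{ru}(G))$, a $*$-homomorphism $q_r:C_b^{ru}(G)\rtimes_{R,r}G\to(C_b^{ru}(G)/C_0(G))\rtimes_{R,r}G$;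 4. $\Phi(G^*(Z))\subseteq\ker q_r$. -/

import Mathlib

set_option linter.unusedSectionVars false
set_option linter.overlappingInstances false

open MeasureTheory Filter Topology
open scoped Pointwise ENNReal NNReal BoundedContinuousFunction CompactlySupported

noncomputable section

section UnitaryHom
variable {G : Type*} [Group G] {H : Type*} [NormedAddCommGroup H] [InnerProductSpace ℂ H]
  [CompleteSpace H]

/-- A homomorphism from a group to the isometric operators takes values in the unitaries. -/
theorem mem_unitary_of_isometric (V : G →* (H →L[ℂ] H)) (hV : ∀ g ξ, ‖V g ξ‖ = ‖ξ‖) (g : G) :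
    V g ∈ unitary (H →L[ℂ] H) := by
  have h1 : star (V g) * V g = 1 := by
    have := (ContinuousLinearMap.norm_map_iff_adjoint_comp_self (V g)).1 (hV g)
    exact this
  have h2 : V g * V g⁻¹ = 1 := by rw [← map_mul]; simp
  refine ⟨h1, ?_⟩
  have h3 : star (V g) = V g⁻¹ := by
    calc star (V g) = star (V g) * (V g * V g⁻¹) := by rw [h2, mul_one]
      _ = V g⁻¹ := by rw [← mul_assoc, h1, one_mul]
  rw [h3, h2]

/-- The unitary representation given by a homomorphism into the isometric operators. -/
def unitaryHom (V : G →* (H →L[ℂ] H)) (hV : ∀ g ξ, ‖V g ξ‖ = ‖ξ‖) :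
    G →* unitary (H →L[ℂ] H) :=
  V.codRestrict (unitary (H →L[ℂ] H)) (mem_unitary_of_isometric V hV)

end UnitaryHom

section Main

variable {G : Type*} [Group G] [TopologicalSpace G] [IsTopologicalGroup G]
  [LocallyCompactSpace G] [SecondCountableTopology G] [MeasurableSpace G] [BorelSpace G]

/-! ### The modular function -/

/-- The modular function, with the convention `μ (E g) = Δ(g) μ(E)` for a left Haar
measure `μ`. (Mathlib's `modularCharacter g` is the scaling factor of `E ↦ μ (E g⁻¹)`.) -/
def modularFn (g : G) : ℝ := ((Measure.modularCharacter g : ℝ≥0) : ℝ)⁻¹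

theorem modularFn_pos (g : G) : 0 < modularFn g :=
  inv_pos.2 (NNReal.coe_pos.2 (Measure.modularCharacterFun_pos g))

theorem modularFn_mul (g h : G) : modularFn (g * h) = modularFn g * modularFn h := by
  simp [modularFn, mul_comm]

theorem modularFn_one : modularFn (1 : G) = 1 := by simp [modularFn]

theorem modularFn_inv (g : G) : modularFn g⁻¹ = (modularFn g)⁻¹ := by
  have h := modularFn_mul g g⁻¹
  rw [mul_inv_cancel, modularFn_one] at h
  exact eq_inv_of_mul_eq_one_right h.symm

theorem map_mul_right_eq (μ : Measure G) [μ.IsHaarMeasure] [μ.Regular] (g : G) :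
    Measure.map (· * g) μ = Measure.modularCharacterFun g • μ :=
  Measure.map_right_mul_eq_modularCharacterFun_smul μ g

theorem integral_mul_right_modular {E : Type*} [NormedAddCommGroup E] [NormedSpace ℝ E]
    (μ : Measure G) [μ.IsHaarMeasure] [μ.Regular] (F : G → E) (g : G) :
    ∫ x, F (x * g) ∂μ = (modularFn g)⁻¹ • ∫ x, F x ∂μ := by
  have h : ∫ x, F x ∂(Measure.map (· * g) μ) = ∫ x, F (x * g) ∂μ :=
    (measurableEmbedding_mulRight g).integral_map F
  rw [← h, map_mul_right_eq, integral_smul_nnreal_measure]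
  simp [modularFn, Measure.modularCharacter, NNReal.smul_def]

theorem continuous_modularFn : Continuous (modularFn : G → ℝ) := by
  let μ : Measure G := Measure.haar
  obtain ⟨⟨f, f_cont⟩, f_comp, f_nonneg, f_one⟩ :
    ∃ f : C(G, ℝ), HasCompactSupport f ∧ 0 ≤ f ∧ f 1 ≠ 0 := exists_continuous_nonneg_pos 1
  have hpos : 0 < ∫ x, f x ∂μ :=
    f_cont.integral_pos_of_hasCompactSupport_nonneg_nonzero f_comp f_nonneg f_one
  have key : ∀ g : G, modularFn g = (∫ x, f x ∂μ) / ∫ x, f (x * g) ∂μ := by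
    intro g
    rw [integral_mul_right_modular μ f g, smul_eq_mul]
    field_simp [(modularFn_pos g).ne']
  have hc : Continuous (fun g : G => ∫ x, f (x * g) ∂μ) := by
    refine continuous_iff_continuousAt.2 fun g₀ => ?_
    obtain ⟨V, hV, hVg⟩ := exists_compact_mem_nhds g₀
    have hk : IsCompact (tsupport f * V⁻¹ : Set G) := f_comp.isCompact.mul hV.inv
    have := continuousOn_integral_of_compact_support (μ := μ) (s := V)
      (f := fun g x => f (x * g)) hk (by fun_prop) (by
        intro g x hg hx
        by_contra hne
        exact hx ⟨x * g, subset_tsupport _ hne, g⁻¹, Set.inv_mem_inv.2 hg, by simp⟩)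
    exact this.continuousAt hVg
  rw [show (modularFn : G → ℝ) = fun g => (∫ x, f x ∂μ) / ∫ x, f (x * g) ∂μ from funext key]
  refine continuous_const.div hc fun g => ?_
  rw [integral_mul_right_modular μ f g, smul_eq_mul]
  exact (mul_pos (inv_pos.2 (modularFn_pos g)) hpos).ne'


/-- Inversion of a left Haar integral: `∫ F(s⁻¹) Δ(s)⁻¹ ds = ∫ F(s) ds`. -/
theorem integral_inv_modular {E : Type*} [NormedAddCommGroup E] [NormedSpace ℝ E]
    [CompleteSpace E] (μ : Measure G) [μ.IsHaarMeasure] [μ.Regular] {F : G → E} (hF : Continuous F)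
    (hFc : HasCompactSupport F) :
    ∫ s, (modularFn s)⁻¹ • F s⁻¹ ∂μ = ∫ s, F s ∂μ := by
  obtain ⟨⟨k, k_cont⟩, k_comp, k_nonneg, k_one⟩ :
    ∃ f : C(G, ℝ), HasCompactSupport f ∧ 0 ≤ f ∧ f 1 ≠ 0 := exists_continuous_nonneg_pos 1
  have hpos : 0 < ∫ x, k x ∂μ :=
    k_cont.integral_pos_of_hasCompactSupport_nonneg_nonzero k_comp k_nonneg k_one
  simp only [ContinuousMap.coe_mk] at k_comp hpos
  have hΔ : Continuous (modularFn : G → ℝ) := continuous_modularFn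
  have e1 : ∀ x, k x • ∫ s, (modularFn s)⁻¹ • F s⁻¹ ∂μ
      = ∫ s, k x • (modularFn (s⁻¹ * x) • F (s⁻¹ * x)) ∂μ := by
    intro x
    rw [integral_smul,
      ← integral_mul_left_eq_self (fun s => (modularFn s)⁻¹ • F s⁻¹) x⁻¹]
    simp [mul_inv_rev, ← modularFn_inv]
  have e2 : ∀ s, ∫ x, k x • (modularFn (s⁻¹ * x) • F (s⁻¹ * x)) ∂μ
      = ∫ x, k (s * x) • (modularFn x • F x) ∂μ := by
    intro s
    rw [← integral_mul_left_eq_self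
      (fun x => k x • (modularFn (s⁻¹ * x) • F (s⁻¹ * x))) s]
    simp
  have e3 : ∀ x, ∫ s, k (s * x) • (modularFn x • F x) ∂μ = (∫ s, k s ∂μ) • F x := by
    intro x
    rw [integral_smul_const, integral_mul_right_modular μ k x, smul_smul, smul_eq_mul,
      mul_comm, ← mul_assoc, mul_inv_cancel₀ (modularFn_pos x).ne', one_mul]
  have c1 : HasCompactSupport (Function.uncurry
      fun x s => k x • (modularFn (s⁻¹ * x) • F (s⁻¹ * x))) := by
    refine HasCompactSupport.intro (K := tsupport k ×ˢ (tsupport k * (tsupport F)⁻¹))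
      (k_comp.isCompact.prod (k_comp.isCompact.mul hFc.isCompact.inv)) ?_
    rintro ⟨x, s⟩ hxs
    by_contra hne
    have hk : k x ≠ 0 := fun h => hne (by simp [h])
    have hf : F (s⁻¹ * x) ≠ 0 := fun h => hne (by simp [h])
    exact hxs ⟨subset_tsupport _ hk, x, subset_tsupport _ hk, (s⁻¹ * x)⁻¹,
      Set.inv_mem_inv.2 (subset_tsupport _ hf), by simp⟩
  have c2 : HasCompactSupport (Function.uncurry
      fun s x => k (s * x) • (modularFn x • F x)) := by
    refine HasCompactSupport.intro (K := (tsupport k * (tsupport F)⁻¹) ×ˢ tsupport F)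
      ((k_comp.isCompact.mul hFc.isCompact.inv).prod hFc.isCompact) ?_
    rintro ⟨s, x⟩ hxs
    by_contra hne
    have hk : k (s * x) ≠ 0 := fun h => hne (by simp [h])
    have hf : F x ≠ 0 := fun h => hne (by simp [h])
    exact hxs ⟨⟨s * x, subset_tsupport _ hk, x⁻¹,
      Set.inv_mem_inv.2 (subset_tsupport _ hf), by simp⟩, subset_tsupport _ hf⟩
  have main : (∫ x, k x ∂μ) • ∫ s, (modularFn s)⁻¹ • F s⁻¹ ∂μ
      = (∫ x, k x ∂μ) • ∫ x, F x ∂μ := by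
    calc (∫ x, k x ∂μ) • ∫ s, (modularFn s)⁻¹ • F s⁻¹ ∂μ
        = ∫ x, k x • ∫ s, (modularFn s)⁻¹ • F s⁻¹ ∂μ ∂μ := (integral_smul_const _ _).symm
      _ = ∫ x, ∫ s, k x • (modularFn (s⁻¹ * x) • F (s⁻¹ * x)) ∂μ ∂μ := by simp_rw [e1]
      _ = ∫ s, ∫ x, k x • (modularFn (s⁻¹ * x) • F (s⁻¹ * x)) ∂μ ∂μ :=
          integral_integral_swap_of_hasCompactSupport (by fun_prop) c1
      _ = ∫ s, ∫ x, k (s * x) • (modularFn x • F x) ∂μ ∂μ := by simp_rw [e2]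
      _ = ∫ x, ∫ s, k (s * x) • (modularFn x • F x) ∂μ ∂μ :=
          integral_integral_swap_of_hasCompactSupport (by fun_prop) c2
      _ = ∫ x, (∫ s, k s ∂μ) • F x ∂μ := by simp_rw [e3]
      _ = _ := integral_smul _ _
  exact smul_right_injective _ hpos.ne' main

/-! ### Actions on C*-algebras, covariant representations and crossed products -/

/-- A strongly continuous action of `G` on a C*-algebra `A` by *-automorphisms, i.e. the
structure of a `G`-C*-algebra on `A`. -/
structure GCStarAction (G : Type*) [Group G] [TopologicalSpace G]
    (A : Type*) [NonUnitalCStarAlgebra A] where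
  /-- the homomorphism into the automorphism group -/
  act : G →* (A ≃⋆ₐ[ℂ] A)
  /-- continuity of the orbit maps -/
  continuous_orbit : ∀ a : A, Continuous fun g => act g a

/-- A covariant representation of a `G`-C*-algebra `A` on a Hilbert space `H`. -/
structure CovariantRep {A : Type*} [NonUnitalCStarAlgebra A] (α : GCStarAction G A)
    (H : Type*) [NormedAddCommGroup H] [InnerProductSpace ℂ H] [CompleteSpace H] where
  /-- the *-representation of `A` -/
  rep : A →⋆ₙₐ[ℂ] (H →L[ℂ] H)
  /-- the unitary representation of `G` -/
  uni : G →* unitary (H →L[ℂ] H)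
  /-- strong continuity of the unitary representation -/
  continuous_uni : ∀ ξ : H, Continuous fun g => (uni g : H →L[ℂ] H) ξ
  /-- covariance -/
  covariant : ∀ g a, (uni g : H →L[ℂ] H) * rep a * star (uni g : H →L[ℂ] H) = rep (α.act g a)

section Action
variable {A : Type*} [NonUnitalCStarAlgebra A] (α : GCStarAction G A)

theorem GCStarAction.norm_act (g : G) (a : A) : ‖α.act g a‖ = ‖a‖ :=
  NonUnitalStarAlgHom.norm_map (α.act g) (α.act g).injective a

theorem GCStarAction.continuous_act : Continuous fun p : G × A => α.act p.1 p.2 := by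
  refine continuous_iff_continuousAt.2 fun ⟨g₀, a₀⟩ => ?_
  rw [ContinuousAt, tendsto_iff_norm_sub_tendsto_zero]
  have h1 : Tendsto (fun p : G × A => ‖p.2 - a₀‖ + ‖α.act p.1 a₀ - α.act g₀ a₀‖)
      (𝓝 (g₀, a₀)) (𝓝 0) := by
    have hc : Continuous (fun p : G × A => ‖p.2 - a₀‖ + ‖α.act p.1 a₀ - α.act g₀ a₀‖) := by
      have := (α.continuous_orbit a₀).comp (continuous_fst (X := G) (Y := A))
      have h' : Continuous fun p : G × A => α.act p.1 a₀ := this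
      fun_prop
    simpa using hc.tendsto (g₀, a₀)
  refine squeeze_zero (fun _ => norm_nonneg _) (fun p => ?_) h1
  calc ‖α.act p.1 p.2 - α.act g₀ a₀‖
      = ‖α.act p.1 (p.2 - a₀) + (α.act p.1 a₀ - α.act g₀ a₀)‖ := by rw [map_sub]; congr 1; abel
    _ ≤ ‖α.act p.1 (p.2 - a₀)‖ + ‖α.act p.1 a₀ - α.act g₀ a₀‖ := norm_add_le _ _
    _ = _ := by rw [α.norm_act]

theorem GCStarAction.continuous_comp_act {X : Type*} [TopologicalSpace X] {u : X → G} {v : X → A}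
    (hu : Continuous u) (hv : Continuous v) : Continuous fun x => α.act (u x) (v x) :=
  α.continuous_act.comp (hu.prodMk hv)

/-- The convolution product `(f * g)(s) = ∫ f(t) α_t(g(t⁻¹ s)) dμ(t)` on `C_c(G, A)`. -/
def GCStarAction.conv (μ : Measure G) [μ.IsHaarMeasure] (f g : C_c(G, A)) : C_c(G, A) where
  toFun s := ∫ t, f t * α.act t (g (t⁻¹ * s)) ∂μ
  continuous_toFun := by
    have hc : Continuous (fun p : G × G => f p.2 * α.act p.2 (g (p.2⁻¹ * p.1))) :=
      (f.continuous.comp continuous_snd).mul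
        (α.continuous_comp_act continuous_snd (g.continuous.comp (by fun_prop)))
    have := continuousOn_integral_of_compact_support (μ := μ) (s := Set.univ)
      (f := fun s t => f t * α.act t (g (t⁻¹ * s))) f.hasCompactSupport.isCompact
      hc.continuousOn (by
        intro s t _ ht
        simp [image_eq_zero_of_notMem_tsupport ht])
    exact continuousOn_univ.1 this
  hasCompactSupport' := by
    refine HasCompactSupport.intro (K := tsupport f * tsupport g)
      (f.hasCompactSupport.isCompact.mul g.hasCompactSupport.isCompact) fun s hs => ?_
    refine integral_eq_zero_of_ae (Eventually.of_forall fun t => ?_)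
    by_contra hne
    have hf : f t ≠ 0 := fun h => hne (by simp [h])
    have hg : g (t⁻¹ * s) ≠ 0 := fun h => hne (by simp [h])
    exact hs ⟨t, subset_tsupport _ hf, t⁻¹ * s, subset_tsupport _ hg, by simp⟩

/-- The involution `f^*(s) = Δ(s)⁻¹ α_s(f(s⁻¹)^*)` on `C_c(G, A)`. -/
def GCStarAction.involution (f : C_c(G, A)) : C_c(G, A) where
  toFun s := (modularFn s)⁻¹ • α.act s (star (f s⁻¹))
  continuous_toFun := by
    have h1 : Continuous (fun s : G => (modularFn s)⁻¹) :=
      continuous_modularFn.inv₀ fun s => (modularFn_pos s).ne'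
    exact h1.smul (α.continuous_comp_act continuous_id
      ((f.continuous.comp continuous_inv).star))
  hasCompactSupport' := by
    refine HasCompactSupport.intro (K := (tsupport f)⁻¹) f.hasCompactSupport.isCompact.inv
      fun s hs => ?_
    have : f s⁻¹ = 0 := by
      by_contra h
      exact hs (Set.mem_inv.2 (subset_tsupport _ h))
    simp [this]

end Action

namespace CovariantRep
variable {A : Type*} [NonUnitalCStarAlgebra A] {α : GCStarAction G A}
  {H : Type*} [NormedAddCommGroup H] [InnerProductSpace ℂ H] [CompleteSpace H]
  (c : CovariantRep α H)

theorem norm_uni (g : G) (ξ : H) : ‖(c.uni g : H →L[ℂ] H) ξ‖ = ‖ξ‖ :=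
  (ContinuousLinearMap.norm_map_iff_adjoint_comp_self _).2 (c.uni g).2.1 ξ

theorem uni_inv (g : G) : (c.uni g⁻¹ : H →L[ℂ] H) = star (c.uni g : H →L[ℂ] H) := by
  rw [map_inv]; rfl

theorem uni_comm (g : G) (a : A) :
    (c.uni g : H →L[ℂ] H) * c.rep a = c.rep (α.act g a) * (c.uni g : H →L[ℂ] H) := by
  rw [← c.covariant, mul_assoc, (c.uni g).2.1, mul_one]

theorem uni_rep_apply (g : G) (a : A) (ξ : H) :
    (c.uni g : H →L[ℂ] H) (c.rep a ξ) = c.rep (α.act g a) ((c.uni g : H →L[ℂ] H) ξ) :=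
  congrArg (fun T : H →L[ℂ] H => T ξ) (c.uni_comm g a)

theorem uni_uni_apply (g h : G) (ξ : H) :
    (c.uni g : H →L[ℂ] H) ((c.uni h : H →L[ℂ] H) ξ) = (c.uni (g * h) : H →L[ℂ] H) ξ := by
  rw [map_mul]; rfl

theorem continuous_uni_apply {X : Type*} [TopologicalSpace X] {u : X → G} {v : X → H}
    (hu : Continuous u) (hv : Continuous v) :
    Continuous fun x => (c.uni (u x) : H →L[ℂ] H) (v x) := by
  suffices h : Continuous fun p : G × H => (c.uni p.1 : H →L[ℂ] H) p.2 from
    h.comp (hu.prodMk hv)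
  refine continuous_iff_continuousAt.2 fun ⟨g₀, a₀⟩ => ?_
  rw [ContinuousAt, tendsto_iff_norm_sub_tendsto_zero]
  have h1 : Tendsto (fun p : G × H => ‖p.2 - a₀‖ +
      ‖(c.uni p.1 : H →L[ℂ] H) a₀ - (c.uni g₀ : H →L[ℂ] H) a₀‖) (𝓝 (g₀, a₀)) (𝓝 0) := by
    have h' : Continuous fun p : G × H => (c.uni p.1 : H →L[ℂ] H) a₀ :=
      (c.continuous_uni a₀).comp continuous_fst
    have hc : Continuous (fun p : G × H => ‖p.2 - a₀‖ +
      ‖(c.uni p.1 : H →L[ℂ] H) a₀ - (c.uni g₀ : H →L[ℂ] H) a₀‖) := by fun_prop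
    simpa using hc.tendsto (g₀, a₀)
  refine squeeze_zero (fun _ => norm_nonneg _) (fun p => ?_) h1
  calc ‖(c.uni p.1 : H →L[ℂ] H) p.2 - (c.uni g₀ : H →L[ℂ] H) a₀‖
      = ‖(c.uni p.1 : H →L[ℂ] H) (p.2 - a₀) +
        ((c.uni p.1 : H →L[ℂ] H) a₀ - (c.uni g₀ : H →L[ℂ] H) a₀)‖ := by
        rw [map_sub]; congr 1; abel
    _ ≤ _ := norm_add_le _ _
    _ = _ := by rw [c.norm_uni]

theorem norm_rep_le (a : A) : ‖c.rep a‖ ≤ ‖a‖ := NonUnitalStarAlgHom.norm_apply_le c.rep a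

theorem continuous_rep : Continuous c.rep :=
  AddMonoidHomClass.continuous_of_bound c.rep 1 fun a => by simpa using c.norm_rep_le a


theorem continuous_integrand (f : C_c(G, A)) (ξ : H) :
    Continuous fun s => c.rep (f s) ((c.uni s : H →L[ℂ] H) ξ) :=
  (c.continuous_rep.comp f.continuous).clm_apply (c.continuous_uni ξ)

theorem integrable_integrand (μ : Measure G) [μ.IsHaarMeasure] (f : C_c(G, A)) (ξ : H) :
    Integrable (fun s => c.rep (f s) ((c.uni s : H →L[ℂ] H) ξ)) μ :=
  (c.continuous_integrand f ξ).integrable_of_hasCompactSupport <|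
    HasCompactSupport.intro f.hasCompactSupport.isCompact fun s hs => by
      simp [image_eq_zero_of_notMem_tsupport hs]

/-- The integrated form `(π ⋊ U)(f) = ∫ π(f(s)) U_s dμ(s)` for `f ∈ C_c(G, A)`, the integral being
taken in the strong operator topology. -/
def integratedForm (μ : Measure G) [μ.IsHaarMeasure] (f : C_c(G, A)) : H →L[ℂ] H :=
  LinearMap.mkContinuous
    { toFun := fun ξ => ∫ s, c.rep (f s) ((c.uni s : H →L[ℂ] H) ξ) ∂μ
      map_add' := fun ξ η => by
        simp only [map_add]
        exact integral_add (c.integrable_integrand μ f ξ) (c.integrable_integrand μ f η)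
      map_smul' := fun z ξ => by
        simp only [map_smul, RingHom.id_apply]
        exact integral_smul _ _ }
    (∫ s, ‖f s‖ ∂μ)
    (fun ξ => by
      change ‖∫ s, c.rep (f s) ((c.uni s : H →L[ℂ] H) ξ) ∂μ‖ ≤ _
      rw [← integral_mul_const]
      refine norm_integral_le_of_norm_le ?_ (Eventually.of_forall fun s => ?_)
      · exact ((f.continuous.norm).integrable_of_hasCompactSupport
          f.hasCompactSupport.norm).mul_const _
      · calc ‖c.rep (f s) ((c.uni s : H →L[ℂ] H) ξ)‖
            ≤ ‖c.rep (f s)‖ * ‖(c.uni s : H →L[ℂ] H) ξ‖ := ContinuousLinearMap.le_opNorm _ _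
          _ ≤ ‖f s‖ * ‖ξ‖ := by
            rw [c.norm_uni]
            exact mul_le_mul_of_nonneg_right (c.norm_rep_le _) (norm_nonneg _))

theorem integratedForm_apply (μ : Measure G) [μ.IsHaarMeasure] (f : C_c(G, A)) (ξ : H) :
    c.integratedForm μ f ξ = ∫ s, c.rep (f s) ((c.uni s : H →L[ℂ] H) ξ) ∂μ := rfl

theorem integratedForm_add (μ : Measure G) [μ.IsHaarMeasure] (f g : C_c(G, A)) :
    c.integratedForm μ (f + g) = c.integratedForm μ f + c.integratedForm μ g := by
  ext ξ
  simp only [integratedForm_apply, add_apply,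
    CompactlySupportedContinuousMap.add_apply, map_add]
  exact integral_add (c.integrable_integrand μ f ξ) (c.integrable_integrand μ g ξ)

theorem integratedForm_smul (μ : Measure G) [μ.IsHaarMeasure] (z : ℂ) (f : C_c(G, A)) :
    c.integratedForm μ (z • f) = z • c.integratedForm μ f := by
  ext ξ
  simp only [integratedForm_apply, smul_apply,
    CompactlySupportedContinuousMap.smul_apply, map_smul]
  exact integral_smul _ _

theorem integratedForm_mul (μ : Measure G) [μ.IsHaarMeasure] (f g : C_c(G, A)) :
    c.integratedForm μ f * c.integratedForm μ g = c.integratedForm μ (α.conv μ f g) := by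
  ext ξ
  change c.integratedForm μ f (c.integratedForm μ g ξ) = _
  simp only [integratedForm_apply]
  have e1 : ∀ s, c.rep (f s) ((c.uni s : H →L[ℂ] H)
      (∫ t, c.rep (g t) ((c.uni t : H →L[ℂ] H) ξ) ∂μ))
      = ∫ t, c.rep (f s * α.act s (g (s⁻¹ * t))) ((c.uni t : H →L[ℂ] H) ξ) ∂μ := by
    intro s
    rw [← integral_mul_left_eq_self (fun t =>
      c.rep (f s * α.act s (g (s⁻¹ * t))) ((c.uni t : H →L[ℂ] H) ξ)) s]
    rw [← ContinuousLinearMap.integral_comp_comm _ (c.integrable_integrand μ g ξ),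
      ← ContinuousLinearMap.integral_comp_comm]
    · refine integral_congr_ae (Eventually.of_forall fun t => ?_)
      simp only [inv_mul_cancel_left, map_mul, mul_apply_eq_comp, uni_rep_apply]
      rfl
    · exact ContinuousLinearMap.integrable_comp _ (c.integrable_integrand μ g ξ)
  simp_rw [e1]
  have hc : Continuous (Function.uncurry fun s t =>
      c.rep (f s * α.act s (g (s⁻¹ * t))) ((c.uni t : H →L[ℂ] H) ξ)) := by
    refine Continuous.clm_apply (c.continuous_rep.comp ?_) ((c.continuous_uni ξ).comp continuous_snd)
    exact (f.continuous.comp continuous_fst).mul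
        (α.continuous_comp_act continuous_fst (g.continuous.comp (by fun_prop)))
  rw [integral_integral_swap_of_hasCompactSupport hc]
  · refine integral_congr_ae (Eventually.of_forall fun t => ?_)
    have hi : Integrable (fun s => f s * α.act s (g (s⁻¹ * t))) μ := by
      refine Continuous.integrable_of_hasCompactSupport ?_ ?_
      · exact f.continuous.mul (α.continuous_comp_act continuous_id (g.continuous.comp (by fun_prop)))
      · exact HasCompactSupport.intro f.hasCompactSupport.isCompact fun s hs => by
          simp [image_eq_zero_of_notMem_tsupport hs]
    let L : A →L[ℂ] H :=
      (ContinuousLinearMap.apply ℂ H ((c.uni t : H →L[ℂ] H) ξ)).comp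
        (⟨(c.rep : A →ₗ[ℂ] (H →L[ℂ] H)), c.continuous_rep⟩ : A →L[ℂ] (H →L[ℂ] H))
    exact L.integral_comp_comm hi
  · refine HasCompactSupport.intro (K := tsupport f ×ˢ (tsupport f * tsupport g))
      (f.hasCompactSupport.isCompact.prod
        (f.hasCompactSupport.isCompact.mul g.hasCompactSupport.isCompact)) ?_
    rintro ⟨s, t⟩ hst
    by_contra hne
    have hf : f s ≠ 0 := fun h => hne (by simp [h])
    have hg : g (s⁻¹ * t) ≠ 0 := fun h => hne (by simp [h])
    exact hst ⟨subset_tsupport _ hf, s, subset_tsupport _ hf, s⁻¹ * t, subset_tsupport _ hg,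
      by simp⟩

theorem integratedForm_star (μ : Measure G) [μ.IsHaarMeasure] [μ.Regular] (f : C_c(G, A)) :
    star (c.integratedForm μ f) = c.integratedForm μ (α.involution f) := by
  symm
  rw [ContinuousLinearMap.star_eq_adjoint]
  rw [ContinuousLinearMap.eq_adjoint_iff]
  intro ξ η
  simp only [integratedForm_apply]
  rw [← integral_inner (c.integrable_integrand μ f η), ← inner_conj_symm,
    ← integral_inner (c.integrable_integrand μ (α.involution f) ξ), ← integral_conj]
  have hF : Continuous fun s => inner ℂ ξ (c.rep (f s) ((c.uni s : H →L[ℂ] H) η)) :=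
    continuous_const.inner (c.continuous_integrand f η)
  have hFc : HasCompactSupport fun s => inner ℂ ξ (c.rep (f s) ((c.uni s : H →L[ℂ] H) η)) :=
    HasCompactSupport.intro f.hasCompactSupport.isCompact fun s hs => by
      simp [image_eq_zero_of_notMem_tsupport hs]
  rw [← integral_inv_modular μ hF hFc]
  refine integral_congr_ae (Eventually.of_forall fun s => ?_)
  change (starRingEnd ℂ) (inner ℂ η (c.rep ((modularFn s)⁻¹ • α.act s (star (f s⁻¹)))
    ((c.uni s : H →L[ℂ] H) ξ))) = _
  rw [inner_conj_symm]
  rw [← Complex.coe_smul, map_smul, smul_apply, inner_smul_left,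
    Complex.conj_ofReal, ← c.uni_rep_apply, map_star]
  simp only [uni_inv, ContinuousLinearMap.star_eq_adjoint]
  rw [← ContinuousLinearMap.adjoint_inner_right, ContinuousLinearMap.adjoint_inner_left]
  simp

/-- The image of `C_c(G, A)` under the integrated form of a covariant representation. -/
def image (μ : Measure G) [μ.IsHaarMeasure] [μ.Regular] : NonUnitalStarSubalgebra ℂ (H →L[ℂ] H) where
  carrier := Set.range (c.integratedForm μ)
  add_mem' := by
    rintro _ _ ⟨f, rfl⟩ ⟨g, rfl⟩
    exact ⟨f + g, c.integratedForm_add μ f g⟩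
  zero_mem' := ⟨0, by ext ξ; simp [integratedForm_apply]⟩
  mul_mem' := by
    rintro _ _ ⟨f, rfl⟩ ⟨g, rfl⟩
    exact ⟨α.conv μ f g, (c.integratedForm_mul μ f g).symm⟩
  smul_mem' := by
    rintro z _ ⟨f, rfl⟩
    exact ⟨z • f, c.integratedForm_smul μ z f⟩
  star_mem' := by
    rintro _ ⟨f, rfl⟩
    exact ⟨α.involution f, (c.integratedForm_star μ f).symm⟩

/-- The crossed product `A ⋊_{(π,U)} G`: the completion of `C_c(G, A)` in the norm
`‖(π ⋊ U)(f)‖`, realised as the norm closure of its image in `B(H)`. -/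
def crossedProduct (μ : Measure G) [μ.IsHaarMeasure] [μ.Regular] :
    NonUnitalStarSubalgebra ℂ (H →L[ℂ] H) :=
  (c.image μ).topologicalClosure

/-- The canonical map `C_c(G, A) → A ⋊_{(π,U)} G`. -/
def ofCc (μ : Measure G) [μ.IsHaarMeasure] [μ.Regular] (f : C_c(G, A)) : c.crossedProduct μ :=
  ⟨c.integratedForm μ f, (c.image μ).le_topologicalClosure ⟨f, rfl⟩⟩

end CovariantRep

/-! ### Multiplication operators and translations on `L²(G, H)` -/

section L2
variable (μ : Measure G) [μ.IsHaarMeasure] [μ.Regular]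
  {H : Type*} [NormedAddCommGroup H] [InnerProductSpace ℂ H] [CompleteSpace H]

theorem memLp_mulOp (F : G →ᵇ (H →L[ℂ] H)) (ξ : Lp H 2 μ) :
    MemLp (fun t => F t (ξ t)) 2 μ := by
  refine MemLp.of_le_mul (c := ‖F‖) (Lp.memLp ξ) ?_ (Eventually.of_forall fun t => ?_)
  · exact (ContinuousLinearMap.id ℂ (H →L[ℂ] H)).aestronglyMeasurable_comp₂
      F.continuous.aestronglyMeasurable (Lp.aestronglyMeasurable ξ)
  · exact ((F t).le_opNorm _).trans
      (mul_le_mul_of_nonneg_right (F.norm_coe_le_norm t) (norm_nonneg _))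

/-- The operator `(F ξ)(t) = F(t) ξ(t)` on `L²(G, H)` given by a bounded norm continuous
function `F : G → B(H)`. -/
def mulOpCLM (F : G →ᵇ (H →L[ℂ] H)) : Lp H 2 μ →L[ℂ] Lp H 2 μ :=
  LinearMap.mkContinuous
    { toFun := fun ξ => (memLp_mulOp μ F ξ).toLp _
      map_add' := fun ξ η => by
        ext1
        filter_upwards [(memLp_mulOp μ F (ξ + η)).coeFn_toLp, (memLp_mulOp μ F ξ).coeFn_toLp,
          (memLp_mulOp μ F η).coeFn_toLp, Lp.coeFn_add ξ η,
          Lp.coeFn_add ((memLp_mulOp μ F ξ).toLp _) ((memLp_mulOp μ F η).toLp _)]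
          with t h1 h2 h3 h4 h5
        rw [h1, h5, Pi.add_apply, h2, h3, h4, Pi.add_apply, map_add]
      map_smul' := fun z ξ => by
        ext1
        filter_upwards [(memLp_mulOp μ F (z • ξ)).coeFn_toLp, (memLp_mulOp μ F ξ).coeFn_toLp,
          Lp.coeFn_smul z ξ, Lp.coeFn_smul z ((memLp_mulOp μ F ξ).toLp _)] with t h1 h2 h3 h4
        rw [h1, RingHom.id_apply, h4, Pi.smul_apply, h2, h3, Pi.smul_apply, map_smul] }
    ‖F‖
    (fun ξ => by
      refine Lp.norm_le_mul_norm_of_ae_le_mul ?_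
      filter_upwards [(memLp_mulOp μ F ξ).coeFn_toLp] with t h1
      simp only [LinearMap.coe_mk, AddHom.coe_mk]
      rw [h1]
      exact ((F t).le_opNorm _).trans
        (mul_le_mul_of_nonneg_right (F.norm_coe_le_norm t) (norm_nonneg _)))

theorem mulOpCLM_ae (F : G →ᵇ (H →L[ℂ] H)) (ξ : Lp H 2 μ) :
    mulOpCLM μ F ξ =ᵐ[μ] fun t => F t (ξ t) := (memLp_mulOp μ F ξ).coeFn_toLp

/-- `mulOpCLM` as a *-homomorphism. -/
def mulOp : (G →ᵇ (H →L[ℂ] H)) →⋆ₙₐ[ℂ] (Lp H 2 μ →L[ℂ] Lp H 2 μ) where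
  toFun := mulOpCLM μ
  map_smul' z F := by
    ext ξ : 1
    ext1
    simp only [MonoidHom.id_apply, smul_apply]
    filter_upwards [mulOpCLM_ae μ (z • F) ξ, mulOpCLM_ae μ F ξ,
      Lp.coeFn_smul z (mulOpCLM μ F ξ)] with t h1 h2 h3
    rw [h1, h3, Pi.smul_apply, h2]
    simp
  map_zero' := by
    ext ξ : 1
    ext1
    filter_upwards [mulOpCLM_ae μ (0 : G →ᵇ (H →L[ℂ] H)) ξ, Lp.coeFn_zero H 2 μ] with t h1 h2
    refine h1.trans (Eq.trans ?_ h2.symm)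
    simp
  map_add' F F' := by
    ext ξ : 1
    ext1
    simp only [add_apply]
    filter_upwards [mulOpCLM_ae μ (F + F') ξ, mulOpCLM_ae μ F ξ, mulOpCLM_ae μ F' ξ,
      Lp.coeFn_add (mulOpCLM μ F ξ) (mulOpCLM μ F' ξ)] with t h1 h2 h3 h4
    rw [h1, h4, Pi.add_apply, h2, h3]
    simp
  map_mul' F F' := by
    ext ξ : 1
    ext1
    simp only [mul_apply_eq_comp]
    filter_upwards [mulOpCLM_ae μ (F * F') ξ, mulOpCLM_ae μ F' ξ,
      mulOpCLM_ae μ F (mulOpCLM μ F' ξ)] with t h1 h2 h3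
    rw [h1, h3, h2]
    simp
  map_star' F := by
    rw [ContinuousLinearMap.star_eq_adjoint, ContinuousLinearMap.eq_adjoint_iff]
    intro ξ η
    rw [L2.inner_def, L2.inner_def]
    refine integral_congr_ae ?_
    filter_upwards [mulOpCLM_ae μ (star F) ξ, mulOpCLM_ae μ F η] with t h1 h2
    rw [h1, h2]
    simp [ContinuousLinearMap.star_eq_adjoint, ContinuousLinearMap.adjoint_inner_left]

theorem mulOp_ae (F : G →ᵇ (H →L[ℂ] H)) (ξ : Lp H 2 μ) :
    mulOp μ F ξ =ᵐ[μ] fun t => F t (ξ t) := mulOpCLM_ae μ F ξ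

/-- Left translation `(λ_g ξ)(t) = ξ(g⁻¹ t)` on `L²(G, H)`, as a homomorphism. -/
def leftTranslation : G →* (Lp H 2 μ →L[ℂ] Lp H 2 μ) where
  toFun g := (Lp.compMeasurePreservingₗᵢ ℂ (fun t => g⁻¹ * t)
    (measurePreserving_mul_left μ g⁻¹)).toContinuousLinearMap
  map_one' := by
    ext ξ : 1
    ext1
    filter_upwards [Lp.coeFn_compMeasurePreserving ξ (measurePreserving_mul_left μ (1 : G)⁻¹)]
      with t h
    refine Eq.trans h ?_
    simp
  map_mul' g h := by
    ext ξ : 1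
    ext1
    have hq := (measurePreserving_mul_left μ g⁻¹).quasiMeasurePreserving.ae
      (Lp.coeFn_compMeasurePreserving ξ (measurePreserving_mul_left μ h⁻¹))
    filter_upwards [Lp.coeFn_compMeasurePreserving ξ (measurePreserving_mul_left μ (g * h)⁻¹),
      Lp.coeFn_compMeasurePreserving
        (Lp.compMeasurePreserving _ (measurePreserving_mul_left μ h⁻¹) ξ)
        (measurePreserving_mul_left μ g⁻¹), hq] with t h1 h2 h3
    refine Eq.trans h1 (Eq.trans ?_ h2.symm)
    refine Eq.trans ?_ h3.symm
    simp [mul_assoc]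

theorem leftTranslation_ae (g : G) (ξ : Lp H 2 μ) :
    leftTranslation μ g ξ =ᵐ[μ] fun t => ξ (g⁻¹ * t) :=
  Lp.coeFn_compMeasurePreserving ξ (measurePreserving_mul_left μ g⁻¹)

theorem norm_leftTranslation (g : G) (ξ : Lp H 2 μ) : ‖leftTranslation μ g ξ‖ = ‖ξ‖ :=
  LinearIsometry.norm_map _ ξ

theorem continuous_leftTranslation (ξ : Lp H 2 μ) : Continuous fun g => leftTranslation μ g ξ := by
  let k : C(G, C(G, G)) := ContinuousMap.curry ⟨fun p : G × G => p.1⁻¹ * p.2, by fun_prop⟩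
  exact (continuous_const (y := ξ)).compMeasurePreservingLp k.continuous
    (fun g => measurePreserving_mul_left μ g⁻¹) (by simp)

end L2

section RightTranslation
variable (μ : Measure G) [μ.IsHaarMeasure] [μ.Regular]

theorem memLp_rho (g : G) (ξ : Lp ℂ 2 μ) :
    MemLp (fun x => ((√(modularFn g) : ℝ) : ℂ) * ξ (x * g)) 2 μ := by
  have h1 : MemLp ξ 2 (Measure.map (· * g) μ) := by
    rw [map_mul_right_eq]
    exact (Lp.memLp ξ).smul_measure (by simp)
  exact (h1.comp_of_map (measurable_mul_const g).aemeasurable).const_mul _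

/-- The operator `(ρ_g ξ)(x) = ξ(x g) Δ(g)^{1/2}` on `L²(G)`, as a linear map. -/
def rhoLin (g : G) : Lp ℂ 2 μ →ₗ[ℂ] Lp ℂ 2 μ where
  toFun ξ := (memLp_rho μ g ξ).toLp _
  map_add' ξ η := by
    ext1
    filter_upwards [(memLp_rho μ g (ξ + η)).coeFn_toLp, (memLp_rho μ g ξ).coeFn_toLp,
      (memLp_rho μ g η).coeFn_toLp,
      (quasiMeasurePreserving_mul_right μ g).ae (Lp.coeFn_add ξ η),
      Lp.coeFn_add ((memLp_rho μ g ξ).toLp _) ((memLp_rho μ g η).toLp _)]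
      with t h1 h2 h3 h4 h5
    rw [h1, h5, Pi.add_apply, h2, h3, h4, Pi.add_apply, mul_add]
  map_smul' z ξ := by
    ext1
    filter_upwards [(memLp_rho μ g (z • ξ)).coeFn_toLp, (memLp_rho μ g ξ).coeFn_toLp,
      (quasiMeasurePreserving_mul_right μ g).ae (Lp.coeFn_smul z ξ),
      Lp.coeFn_smul z ((memLp_rho μ g ξ).toLp _)] with t h1 h2 h3 h4
    rw [h1, RingHom.id_apply, h4, Pi.smul_apply, h2, h3, Pi.smul_apply, smul_eq_mul, smul_eq_mul]
    ring

theorem rhoLin_ae (g : G) (ξ : Lp ℂ 2 μ) :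
    rhoLin μ g ξ =ᵐ[μ] fun x => ((√(modularFn g) : ℝ) : ℂ) * ξ (x * g) :=
  (memLp_rho μ g ξ).coeFn_toLp

theorem norm_rhoLin (g : G) (ξ : Lp ℂ 2 μ) : ‖rhoLin μ g ξ‖ = ‖ξ‖ := by
  have h : inner ℂ (rhoLin μ g ξ) (rhoLin μ g ξ) = inner ℂ ξ ξ := by
    rw [L2.inner_def, L2.inner_def]
    have h1 : ∫ x, inner ℂ (rhoLin μ g ξ x) (rhoLin μ g ξ x) ∂μ
        = ∫ x, (modularFn g) • inner ℂ (ξ (x * g)) (ξ (x * g)) ∂μ := by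
      refine integral_congr_ae ?_
      filter_upwards [rhoLin_ae μ g ξ] with x hx
      rw [hx]
      simp only [RCLike.inner_apply, map_mul, Complex.conj_ofReal, Complex.real_smul]
      have h2 : ((√(modularFn g) : ℝ) : ℂ) * ((√(modularFn g) : ℝ) : ℂ) = (modularFn g : ℂ) := by
        rw [← Complex.ofReal_mul, Real.mul_self_sqrt (modularFn_pos g).le]
      rw [← h2]
      ring
    rw [h1, integral_smul, integral_mul_right_modular μ (fun x => inner ℂ (ξ x) (ξ x)) g, smul_smul,
      mul_inv_cancel₀ (modularFn_pos g).ne', one_smul]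
  have h' : ‖rhoLin μ g ξ‖ ^ 2 = ‖ξ‖ ^ 2 := by
    rw [@norm_sq_eq_re_inner ℂ, @norm_sq_eq_re_inner ℂ, h]
  exact (sq_eq_sq₀ (norm_nonneg _) (norm_nonneg _)).1 h'

/-- The right regular representation `(ρ_g ξ)(x) = ξ(x g) Δ(g)^{1/2}` on `L²(G)`,
as a homomorphism. -/
def rightTranslation : G →* (Lp ℂ 2 μ →L[ℂ] Lp ℂ 2 μ) where
  toFun g := (⟨rhoLin μ g, norm_rhoLin μ g⟩ : Lp ℂ 2 μ →ₗᵢ[ℂ] Lp ℂ 2 μ).toContinuousLinearMap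
  map_one' := by
    ext ξ : 1
    ext1
    refine (rhoLin_ae μ 1 ξ).trans (Eventually.of_forall fun x => ?_)
    simp [modularFn_one]
  map_mul' g h := by
    ext ξ : 1
    ext1
    have hq := (quasiMeasurePreserving_mul_right μ g).ae (rhoLin_ae μ h ξ)
    filter_upwards [rhoLin_ae μ (g * h) ξ, rhoLin_ae μ g (rhoLin μ h ξ), hq] with x h1 h2 h3
    refine Eq.trans h1 (Eq.trans ?_ h2.symm)
    rw [h3, modularFn_mul, Real.sqrt_mul (modularFn_pos g).le]
    push_cast
    rw [mul_assoc, mul_assoc]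

theorem rightTranslation_ae (g : G) (ξ : Lp ℂ 2 μ) :
    rightTranslation μ g ξ =ᵐ[μ] fun x => ((√(modularFn g) : ℝ) : ℂ) * ξ (x * g) :=
  rhoLin_ae μ g ξ

theorem norm_rightTranslation (g : G) (ξ : Lp ℂ 2 μ) : ‖rightTranslation μ g ξ‖ = ‖ξ‖ :=
  norm_rhoLin μ g ξ

theorem continuous_inner_rightTranslation {f : G → ℂ} (hf : Continuous f)
    (hfc : HasCompactSupport f) (hf2 : MemLp f 2 μ) :
    Continuous fun g => inner ℂ (hf2.toLp f) (rightTranslation μ g (hf2.toLp f)) := by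
  have h1 : ∀ g, inner ℂ (hf2.toLp f) (rightTranslation μ g (hf2.toLp f))
      = ∫ x, (starRingEnd ℂ) (f x) * (((√(modularFn g) : ℝ) : ℂ) * f (x * g)) ∂μ := by
    intro g
    rw [L2.inner_def]
    refine integral_congr_ae ?_
    filter_upwards [hf2.coeFn_toLp, rightTranslation_ae μ g (hf2.toLp f),
      (quasiMeasurePreserving_mul_right μ g).ae hf2.coeFn_toLp] with x h2 h3 h4
    rw [h2, h3, h4, RCLike.inner_apply, mul_comm]
  simp_rw [h1]
  have hΔ : Continuous (modularFn : G → ℝ) := continuous_modularFn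
  have := continuousOn_integral_of_compact_support (μ := μ) (s := Set.univ)
    (f := fun g x => (starRingEnd ℂ) (f x) * (((√(modularFn g) : ℝ) : ℂ) * f (x * g)))
    hfc.isCompact (by
      refine Continuous.continuousOn ?_
      have hs : Continuous fun p : G × G => ((√(modularFn p.1) : ℝ) : ℂ) := by fun_prop
      have hc : Continuous fun p : G × G => (starRingEnd ℂ) (f p.2) :=
        RCLike.continuous_conj.comp (hf.comp continuous_snd)
      have hd : Continuous fun p : G × G => f (p.2 * p.1) := hf.comp (by fun_prop)
      exact hc.mul (hs.mul hd)) (by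
      intro g x _ hx
      simp [image_eq_zero_of_notMem_tsupport hx])
  exact continuousOn_univ.1 this

theorem tendsto_rightTranslation_one (ξ : Lp ℂ 2 μ) :
    Tendsto (fun g => rightTranslation μ g ξ) (𝓝 1) (𝓝 ξ) := by
  rw [Metric.tendsto_nhds]
  intro ε hε
  obtain ⟨f, hfc, hfe, hf, hf2⟩ := (Lp.memLp ξ).exists_hasCompactSupport_eLpNorm_sub_le
    (p := 2) (by simp) (ε := ENNReal.ofReal (ε / 4)) (by simpa using by positivity)
  set η := hf2.toLp f with hη
  have hd : ‖ξ - η‖ ≤ ε / 4 := by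
    have : ξ - η = ((Lp.memLp ξ).sub hf2).toLp _ := by
      rw [MemLp.toLp_sub (Lp.memLp ξ) hf2, Lp.toLp_coeFn]
    rw [this, Lp.norm_toLp]
    exact ENNReal.toReal_le_of_le_ofReal (by positivity) hfe
  have hη1 : Tendsto (fun g => ‖rightTranslation μ g η - η‖ ^ 2) (𝓝 1) (𝓝 0) := by
    have e : ∀ g, ‖rightTranslation μ g η - η‖ ^ 2
        = 2 * ‖η‖ ^ 2 - 2 * RCLike.re (inner ℂ η (rightTranslation μ g η)) := by
      intro g
      rw [@norm_sub_sq ℂ, norm_rightTranslation, inner_re_symm]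
      ring
    have hc : Continuous fun g => 2 * ‖η‖ ^ 2 - 2 * RCLike.re (inner ℂ η (rightTranslation μ g η)) := by
      have := continuous_inner_rightTranslation μ hf hfc hf2
      exact continuous_const.sub (continuous_const.mul (RCLike.continuous_re.comp this))
    have h0 := hc.tendsto 1
    simp only [map_one, one_apply_eq_self, inner_self_eq_norm_sq, sub_self] at h0
    simpa only [e] using h0
  have hη2 : ∀ᶠ g in 𝓝 (1 : G), ‖rightTranslation μ g η - η‖ ^ 2 < (ε / 4) ^ 2 :=
    hη1.eventually (gt_mem_nhds (by positivity))
  filter_upwards [hη2] with g hg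
  have hg' : ‖rightTranslation μ g η - η‖ < ε / 4 := lt_of_pow_lt_pow_left₀ 2 (by positivity) hg
  rw [dist_eq_norm]
  calc ‖rightTranslation μ g ξ - ξ‖
      = ‖rightTranslation μ g (ξ - η) + (rightTranslation μ g η - η) - (ξ - η)‖ := by
        rw [map_sub]; congr 1; abel
    _ ≤ ‖rightTranslation μ g (ξ - η)‖ + ‖rightTranslation μ g η - η‖ + ‖ξ - η‖ :=
        (norm_sub_le _ _).trans (by gcongr; exact norm_add_le _ _)
    _ < ε := by rw [norm_rightTranslation]; linarith

theorem continuous_rightTranslation (ξ : Lp ℂ 2 μ) :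
    Continuous fun g => rightTranslation μ g ξ := by
  refine continuous_iff_continuousAt.2 fun g₀ => ?_
  have h1 : Tendsto (fun g => g₀⁻¹ * g) (𝓝 g₀) (𝓝 1) := by
    have : Continuous fun g => g₀⁻¹ * g := by fun_prop
    simpa using this.tendsto g₀
  have h2 := ((rightTranslation μ g₀).continuous.tendsto ξ).comp
    ((tendsto_rightTranslation_one μ ξ).comp h1)
  refine h2.congr fun g => ?_
  have : rightTranslation μ g = rightTranslation μ g₀ * rightTranslation μ (g₀⁻¹ * g) := by
    rw [← map_mul]; simp
  exact (congrArg (fun T : Lp ℂ 2 μ →L[ℂ] Lp ℂ 2 μ => T ξ) this).symm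

end RightTranslation

/-! ### The regular representation and the reduced crossed product -/

section Regular
variable {A : Type*} [NonUnitalCStarAlgebra A] (α : GCStarAction G A)
  {H : Type*} [NormedAddCommGroup H] [InnerProductSpace ℂ H] [CompleteSpace H]
  (π : A →⋆ₙₐ[ℂ] (H →L[ℂ] H))

theorem continuous_starHom {A B : Type*} [NonUnitalCStarAlgebra A] [NonUnitalCStarAlgebra B]
    (θ : A →⋆ₙₐ[ℂ] B) : Continuous θ :=
  AddMonoidHomClass.continuous_of_bound θ 1 fun a => by
    simpa using NonUnitalStarAlgHom.norm_apply_le θ a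

/-- The *-homomorphism sending `a` to the bounded continuous function `t ↦ π(α_{t⁻¹}(a))`. -/
def orbitHom : A →⋆ₙₐ[ℂ] (G →ᵇ (H →L[ℂ] H)) where
  toFun a := BoundedContinuousFunction.ofNormedAddCommGroup (fun t => π (α.act t⁻¹ a))
    ((continuous_starHom π).comp ((α.continuous_orbit a).comp continuous_inv)) ‖a‖
    (fun t => (NonUnitalStarAlgHom.norm_apply_le π _).trans (α.norm_act _ _).le)
  map_smul' z a := by ext t : 1; simp
  map_zero' := by ext t : 1; simp
  map_add' a b := by ext t : 1; simp
  map_mul' a b := by ext t : 1; simp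
  map_star' a := by ext t : 1; simp [map_star]

theorem orbitHom_apply (a : A) (t : G) : orbitHom α π a t = π (α.act t⁻¹ a) := rfl

variable (μ : Measure G) [μ.IsHaarMeasure] [μ.Regular]

/-- The covariant representation `(π_α, λ ⊗ 1)` on `L²(G, H)` with
`(π_α(a) ξ)(t) = π(α_{t⁻¹}(a)) ξ(t)` and `((λ_g ⊗ 1) ξ)(t) = ξ(g⁻¹ t)`. -/
def regularRep : CovariantRep α (Lp H 2 μ) where
  rep := (mulOp μ).comp (orbitHom α π)
  uni := unitaryHom (leftTranslation μ) (norm_leftTranslation μ)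
  continuous_uni := continuous_leftTranslation μ
  covariant g a := by
    have key : leftTranslation μ g * mulOp μ (orbitHom α π a)
        = mulOp μ (orbitHom α π (α.act g a)) * leftTranslation μ g := by
      ext ξ : 1
      ext1
      simp only [mul_apply_eq_comp]
      filter_upwards [leftTranslation_ae μ g (mulOp μ (orbitHom α π a) ξ),
        (measurePreserving_mul_left μ g⁻¹).quasiMeasurePreserving.ae (mulOp_ae μ (orbitHom α π a) ξ),
        mulOp_ae μ (orbitHom α π (α.act g a)) (leftTranslation μ g ξ),
        leftTranslation_ae μ g ξ] with t h1 h2 h3 h4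
      rw [h1, h2, h3, h4, orbitHom_apply, orbitHom_apply, mul_inv_rev, inv_inv, map_mul]
      rfl
    have hu := (mem_unitary_of_isometric (leftTranslation (H := H) μ) (norm_leftTranslation μ) g).2
    change leftTranslation μ g * mulOp μ (orbitHom α π a) *
      star (leftTranslation μ g : Lp H 2 μ →L[ℂ] Lp H 2 μ) = _
    rw [key, mul_assoc, hu, mul_one]
    rfl

/-- The reduced crossed product `A ⋊_{α,r} G`, formed from the *-representation `π` of `A` (which
has to be faithful): the completion of `C_c(G, A)` in the reduced norm
`‖(π_α ⋊ (λ ⊗ 1))(f)‖`, realised as a C*-algebra of operators on `L²(G, H)`. -/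
abbrev reducedCrossedProduct : NonUnitalStarSubalgebra ℂ (Lp H 2 μ →L[ℂ] Lp H 2 μ) :=
  (regularRep α π μ).crossedProduct μ

end Regular

/-- The map `C_c(G, A) → C_c(G, B)`, `f ↦ θ ∘ f`, induced by a *-homomorphism `θ : A → B`. -/
def ccMap {A B : Type*} [NonUnitalCStarAlgebra A] [NonUnitalCStarAlgebra B]
    (θ : A →⋆ₙₐ[ℂ] B) (f : C_c(G, A)) : C_c(G, B) where
  toFun s := θ (f s)
  continuous_toFun := (continuous_starHom θ).comp f.continuous
  hasCompactSupport' := f.hasCompactSupport.comp_left (map_zero θ)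

/-! ### Right uniformly continuous functions, `C_0(G)` and the quotient -/

section Cbru
variable (G : Type*) [Group G] [TopologicalSpace G] [IsTopologicalGroup G]

/-- `C_b^{ru}(G)`: the bounded continuous functions `f` with `‖R_g f - f‖_∞ → 0` as `g → e`, where
`(R_g f)(x) = f(x g)`. -/
def CbruSubalgebra : StarSubalgebra ℂ (G →ᵇ ℂ) where
  carrier := {f | ∀ ε > 0, ∀ᶠ g in 𝓝 (1 : G), ∀ x, ‖f (x * g) - f x‖ < ε}
  mul_mem' := by
    intro f f' hf hf' ε hε
    have hC : 0 < ‖f‖ + ‖f'‖ + 1 := by positivity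
    filter_upwards [hf (ε / (2 * (‖f‖ + ‖f'‖ + 1))) (by positivity),
      hf' (ε / (2 * (‖f‖ + ‖f'‖ + 1))) (by positivity)] with g h1 h2 x
    set δ := ε / (2 * (‖f‖ + ‖f'‖ + 1)) with hδ
    have hδ' : δ * (‖f‖ + ‖f'‖ + 1) = ε / 2 := by rw [hδ]; field_simp
    have hδ0 : 0 < δ := by positivity
    have e : (f * f') (x * g) - (f * f') x
        = f (x * g) * (f' (x * g) - f' x) + (f (x * g) - f x) * f' x := by
      simp only [BoundedContinuousFunction.mul_apply]; ring
    rw [e]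
    calc _ ≤ ‖f (x * g)‖ * ‖f' (x * g) - f' x‖ + ‖f (x * g) - f x‖ * ‖f' x‖ := by
            refine (norm_add_le _ _).trans ?_
            rw [norm_mul, norm_mul]
      _ ≤ ‖f‖ * δ + δ * ‖f'‖ := by
            gcongr
            · exact f.norm_coe_le_norm _
            · exact (h2 x).le
            · exact (h1 x).le
            · exact f'.norm_coe_le_norm _
      _ < ε := by nlinarith
  add_mem' := by
    intro f f' hf hf' ε hε
    filter_upwards [hf (ε / 2) (by positivity), hf' (ε / 2) (by positivity)] with g h1 h2 x
    have e : (f + f') (x * g) - (f + f') x = (f (x * g) - f x) + (f' (x * g) - f' x) := by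
      simp only [BoundedContinuousFunction.add_apply]; ring
    rw [e]
    exact (norm_add_le _ _).trans_lt (by linarith [h1 x, h2 x])
  algebraMap_mem' := by
    intro z ε hε
    refine Eventually.of_forall fun g x => ?_
    simpa [Algebra.algebraMap_eq_smul_one] using hε
  star_mem' := by
    intro f hf ε hε
    filter_upwards [hf ε hε] with g h1 x
    have e : (star f) (x * g) - (star f) x = star (f (x * g) - f x) := by simp
    rw [e, norm_star]
    exact h1 x

variable {G}

instance isClosed_Cbru : IsClosed (CbruSubalgebra G : Set (G →ᵇ ℂ)) := by
  refine isClosed_of_closure_subset fun f hf => ?_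
  intro ε hε
  obtain ⟨f', hf', hd⟩ := Metric.mem_closure_iff.1 hf (ε / 3) (by positivity)
  filter_upwards [hf' (ε / 3) (by positivity)] with g h1 x
  have h2 : ∀ y, ‖f y - f' y‖ < ε / 3 := fun y => by
    rw [← dist_eq_norm]; exact (BoundedContinuousFunction.dist_coe_le_dist y).trans_lt hd
  have e : f (x * g) - f x = (f (x * g) - f' (x * g)) + (f' (x * g) - f' x) - (f x - f' x) := by
    ring
  rw [e]
  calc _ ≤ ‖f (x * g) - f' (x * g)‖ + ‖f' (x * g) - f' x‖ + ‖f x - f' x‖ :=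
        (norm_sub_le _ _).trans (by gcongr; exact norm_add_le _ _)
    _ < ε := by linarith [h1 x, h2 x, h2 (x * g)]

variable (G) in
/-- The C*-algebra `C_b^{ru}(G)`, with pointwise operations and the supremum norm. -/
def Cbru : Type _ := CbruSubalgebra G

instance : CommCStarAlgebra (Cbru G) := StarSubalgebra.commCStarAlgebra (CbruSubalgebra G)

theorem Cbru_norm_le {f : Cbru G} {C : ℝ} (hC : 0 ≤ C) (h : ∀ x, ‖f.1 x‖ ≤ C) : ‖f‖ ≤ C :=
  (BoundedContinuousFunction.norm_le hC).2 h

/-- Composition of an element of `C_b^{ru}(G)` with a continuous function is in `C_b^{ru}(G)`. -/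
theorem exists_Cbru_comp (f : Cbru G) {φ : ℂ → ℂ} (hφ : Continuous φ) :
    ∃ k : Cbru G, ∀ x, k.1 x = φ (f.1 x) := by
  have hcomp : IsCompact (Metric.closedBall (0 : ℂ) ‖f.1‖) := isCompact_closedBall _ _
  have hmem : ∀ x, f.1 x ∈ Metric.closedBall (0 : ℂ) ‖f.1‖ := fun x => by
    simpa using f.1.norm_coe_le_norm x
  obtain ⟨C, hC⟩ := (hcomp.image hφ).isBounded.exists_norm_le
  refine ⟨⟨BoundedContinuousFunction.ofNormedAddCommGroup (fun x => φ (f.1 x))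
    (hφ.comp f.1.continuous) C (fun x => hC _ ⟨_, hmem x, rfl⟩), ?_⟩, fun x => rfl⟩
  intro ε hε
  have huc := hcomp.uniformContinuousOn_of_continuous hφ.continuousOn
  obtain ⟨δ, hδ, hd⟩ := Metric.uniformContinuousOn_iff.1 huc ε hε
  filter_upwards [f.2 δ hδ] with g hg x
  have := hd _ (hmem (x * g)) _ (hmem x) (by rw [dist_eq_norm]; exact hg x)
  rw [dist_eq_norm] at this
  exact this

/-- Right translation `(R_g f)(x) = f(x g)` on `C_b^{ru}(G)`. -/
def rightTranslate (g : G) (f : Cbru G) : Cbru G :=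
  ⟨f.1.compContinuous ⟨fun x => x * g, by fun_prop⟩, by
    intro ε hε
    have hc : Tendsto (fun h : G => g⁻¹ * h * g) (𝓝 1) (𝓝 1) := by
      have : Continuous fun h : G => g⁻¹ * h * g := by fun_prop
      simpa using this.tendsto 1
    filter_upwards [hc.eventually (f.2 ε hε)] with h hh x
    have := hh (x * g)
    simpa [mul_assoc] using this⟩

theorem rightTranslate_apply (g : G) (f : Cbru G) (x : G) :
    (rightTranslate g f).1 x = f.1 (x * g) := rfl

theorem Cbru_ext {f f' : Cbru G} (h : ∀ x, f.1 x = f'.1 x) : f = f' :=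
  Subtype.ext (BoundedContinuousFunction.ext h)

theorem rightTranslate_mul (g h : G) (f : Cbru G) :
    rightTranslate (g * h) f = rightTranslate g (rightTranslate h f) :=
  Cbru_ext fun x => by simp [rightTranslate_apply, mul_assoc]

theorem rightTranslate_one (f : Cbru G) : rightTranslate (1 : G) f = f :=
  Cbru_ext fun x => by simp [rightTranslate_apply]

/-- The action `R` of `G` on `C_b^{ru}(G)` by right translations. -/
def actionR : GCStarAction G (Cbru G) where
  act :=
    { toFun := fun g =>
        { toFun := rightTranslate g
          invFun := rightTranslate g⁻¹
          left_inv := fun f => by rw [← rightTranslate_mul, inv_mul_cancel, rightTranslate_one]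
          right_inv := fun f => by rw [← rightTranslate_mul, mul_inv_cancel, rightTranslate_one]
          map_mul' := fun f f' => Cbru_ext fun x => rfl
          map_add' := fun f f' => Cbru_ext fun x => rfl
          map_star' := fun f => Cbru_ext fun x => rfl
          map_smul' := fun z f => Cbru_ext fun x => rfl }
      map_one' := by ext f : 1; exact rightTranslate_one f
      map_mul' := fun g h => by ext f : 1; exact rightTranslate_mul g h f }
  continuous_orbit f := by
    change Continuous fun g => rightTranslate g f
    refine continuous_iff_continuousAt.2 fun g₀ => Metric.tendsto_nhds.2 fun ε hε => ?_
    have h1 : Tendsto (fun g => g₀⁻¹ * g) (𝓝 g₀) (𝓝 1) := by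
      have : Continuous fun g => g₀⁻¹ * g := by fun_prop
      simpa using this.tendsto g₀
    filter_upwards [h1.eventually (f.2 (ε / 2) (by positivity))] with g hg
    rw [dist_eq_norm]
    refine (Cbru_norm_le (C := ε / 2) (by positivity) fun x => ?_).trans_lt (by linarith)
    have := (hg (x * g₀)).le
    rw [mul_assoc, mul_inv_cancel_left] at this
    exact this

theorem actionR_apply (g : G) (f : Cbru G) (x : G) : (actionR.act g f).1 x = f.1 (x * g) := rfl

variable (G) in
/-- `C_0(G)` as an ideal of `C_b^{ru}(G)` (continuous functions vanishing at infinity are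
automatically uniformly continuous). -/
def C0Ideal : Ideal (Cbru G) where
  carrier := {f | Tendsto f.1 (cocompact G) (𝓝 0)}
  add_mem' {f f'} hf hf' := by simpa using! Tendsto.add hf hf'
  zero_mem' := tendsto_const_nhds
  smul_mem' f f' hf' := by
    have hb : IsBoundedUnder (· ≤ ·) (cocompact G) (norm ∘ f.1) :=
      ⟨‖f.1‖, by simpa using Eventually.of_forall f.1.norm_coe_le_norm⟩
    exact Filter.isBoundedUnder_le_mul_tendsto_zero hb hf'

theorem mem_C0Ideal {f : Cbru G} : f ∈ C0Ideal G ↔ Tendsto f.1 (cocompact G) (𝓝 0) := Iff.rfl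

instance isClosed_C0Ideal : IsClosed (C0Ideal G : Set (Cbru G)) := by
  refine isClosed_of_closure_subset fun f hf => ?_
  refine Metric.tendsto_nhds.2 fun ε hε => ?_
  obtain ⟨f', hf', hd⟩ := Metric.mem_closure_iff.1 hf (ε / 2) (by positivity)
  filter_upwards [Metric.tendsto_nhds.1 hf' (ε / 2) (by positivity)] with x hx
  calc dist (f.1 x) 0 ≤ dist (f.1 x) (f'.1 x) + dist (f'.1 x) 0 := dist_triangle _ _ _
    _ < ε := by
      have : dist (f.1 x) (f'.1 x) < ε / 2 :=
        (BoundedContinuousFunction.dist_coe_le_dist x).trans_lt hd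
      linarith

theorem star_mem_C0Ideal {f : Cbru G} (hf : f ∈ C0Ideal G) : star f ∈ C0Ideal G := by
  have := (continuous_star.tendsto (0 : ℂ)).comp (mem_C0Ideal.1 hf)
  rw [star_zero] at this
  exact this

theorem rightTranslate_mem_C0Ideal (g : G) {f : Cbru G} (hf : f ∈ C0Ideal G) :
    rightTranslate g f ∈ C0Ideal G :=
  (mem_C0Ideal.1 hf).comp (Homeomorph.mulRight g).isClosedEmbedding.tendsto_cocompact

variable (G) in
/-- The quotient `C_b^{ru}(G) / C_0(G)`, with the quotient norm. -/
abbrev CbruModC0 : Type _ := Cbru G ⧸ C0Ideal G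

instance : StarRing (CbruModC0 G) where
  star := Ideal.quotientMap (C0Ideal G) (starRingEnd (Cbru G)) fun _ hf => star_mem_C0Ideal hf
  star_involutive x := by
    obtain ⟨f, rfl⟩ := Ideal.Quotient.mk_surjective x
    change Ideal.Quotient.mk (C0Ideal G) (star (star f)) = _
    rw [star_star]
  star_mul x y := by
    change Ideal.quotientMap _ _ _ _ = Ideal.quotientMap _ _ _ _ * Ideal.quotientMap _ _ _ _
    rw [map_mul, mul_comm]
  star_add x y := map_add (Ideal.quotientMap _ _ _) x y

theorem star_mk (f : Cbru G) :
    star (Ideal.Quotient.mk (C0Ideal G) f) = Ideal.Quotient.mk (C0Ideal G) (star f) := rfl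

/-- If `|f| ≤ r` outside a compact set then the class of `f` has norm at most `r`. -/
theorem norm_mk_le_of_eventually {f : Cbru G} {r : ℝ} (hr : 0 < r)
    (hf : ∀ᶠ x in cocompact G, ‖f.1 x‖ ≤ r) : ‖Ideal.Quotient.mk (C0Ideal G) f‖ ≤ r := by
  have hm : ∀ z : ℂ, 0 < max r ‖z‖ := fun z => lt_max_of_lt_left hr
  obtain ⟨k, hk⟩ := exists_Cbru_comp f (φ := fun z => ((r / max r ‖z‖ : ℝ) : ℂ) * z) (by
    have : Continuous fun z : ℂ => r / max r ‖z‖ :=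
      continuous_const.div (by fun_prop) fun z => (hm z).ne'
    exact (Complex.continuous_ofReal.comp this).mul continuous_id)
  have e : Ideal.Quotient.mk (C0Ideal G) f = Ideal.Quotient.mk (C0Ideal G) k := by
    rw [Ideal.Quotient.mk_eq_mk_iff_sub_mem, mem_C0Ideal]
    refine tendsto_const_nhds.congr' ?_
    filter_upwards [hf] with x hx
    have : (f - k).1 x = f.1 x - k.1 x := rfl
    rw [this, hk, max_eq_left hx, div_self hr.ne']
    simp
  rw [e]
  refine (Ideal.Quotient.norm_mk_le _ k).trans (Cbru_norm_le hr.le fun x => ?_)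
  rw [hk, norm_mul, Complex.norm_real, Real.norm_of_nonneg (div_nonneg hr.le (hm _).le),
    div_mul_eq_mul_div, div_le_iff₀ (hm _)]
  exact mul_le_mul_of_nonneg_left (le_max_right _ _) hr.le

instance : CommCStarAlgebra (CbruModC0 G) where
  complete := (QuotientAddGroup.completeSpace_left (Cbru G) (C0Ideal G).toAddSubgroup).complete
  norm_mul_self_le x := by
    obtain ⟨f, rfl⟩ := Ideal.Quotient.mk_surjective x
    by_contra hlt
    rw [not_le] at hlt
    set N := ‖star (Ideal.Quotient.mk (C0Ideal G) f) * Ideal.Quotient.mk (C0Ideal G) f‖ with hN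
    set c := ‖Ideal.Quotient.mk (C0Ideal G) f‖ with hc
    have hN0 : 0 ≤ N := norm_nonneg _
    have hc0 : 0 ≤ c := norm_nonneg _
    obtain ⟨s, hs1, hs2⟩ := exists_between hlt
    have hs0 : 0 < s := hN0.trans_lt hs1
    obtain ⟨m, hm, hms⟩ := Ideal.Quotient.norm_mk_lt
      (star (Ideal.Quotient.mk (C0Ideal G) f) * Ideal.Quotient.mk (C0Ideal G) f)
      (ε := s - N) (by linarith)
    rw [← hN, add_sub_cancel, star_mk, ← map_mul, Ideal.Quotient.mk_eq_mk_iff_sub_mem] at *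
    have hev := Metric.tendsto_nhds.1 (mem_C0Ideal.1 hm) (s - ‖m‖) (by linarith)
    have hle : c ≤ √s := by
      refine norm_mk_le_of_eventually (Real.sqrt_pos.2 hs0) ?_
      filter_upwards [hev] with x hx
      refine Real.le_sqrt_of_sq_le ?_
      have h1 : ‖m.1 x - star (f.1 x) * f.1 x‖ < s - ‖m‖ := by simpa using! hx
      have h2 : ‖m.1 x‖ ≤ ‖m‖ := m.1.norm_coe_le_norm x
      have h3 : ‖star (f.1 x) * f.1 x‖ = ‖f.1 x‖ ^ 2 := by rw [norm_mul, norm_star, sq]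
      have h4 : ‖star (f.1 x) * f.1 x‖ ≤ ‖m.1 x‖ + ‖m.1 x - star (f.1 x) * f.1 x‖ := by
        have := norm_sub_le (m.1 x) (m.1 x - star (f.1 x) * f.1 x)
        simpa using this
      linarith
    have : c * c ≤ s := by
      calc c * c ≤ √s * √s := mul_le_mul hle hle hc0 (Real.sqrt_nonneg _)
        _ = s := Real.mul_self_sqrt hs0.le
    linarith
  star_smul z x := by
    obtain ⟨f, rfl⟩ := Ideal.Quotient.mk_surjective x
    change Ideal.Quotient.mk (C0Ideal G) (star (z • f)) = _
    rw [star_smul]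
    rfl

/-- The quotient map `C_b^{ru}(G) → C_b^{ru}(G) / C_0(G)`. -/
def quotientHom : Cbru G →⋆ₙₐ[ℂ] CbruModC0 G where
  toFun := Ideal.Quotient.mk (C0Ideal G)
  map_smul' _ _ := rfl
  map_zero' := map_zero _
  map_add' := map_add _
  map_mul' := map_mul _
  map_star' _ := rfl

/-- Right translation by `g` as a ring homomorphism. -/
def rightTranslateHom (g : G) : Cbru G →+* Cbru G where
  toFun := rightTranslate g
  map_one' := Cbru_ext fun _ => rfl
  map_mul' _ _ := Cbru_ext fun _ => rfl
  map_zero' := Cbru_ext fun _ => rfl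
  map_add' _ _ := Cbru_ext fun _ => rfl

/-- The translation by `g` on the quotient. -/
def quotientTranslate (g : G) : CbruModC0 G →+* CbruModC0 G :=
  Ideal.quotientMap (C0Ideal G) (rightTranslateHom g)
    fun _ hf => rightTranslate_mem_C0Ideal g hf

theorem quotientTranslate_mk (g : G) (f : Cbru G) :
    quotientTranslate g (Ideal.Quotient.mk (C0Ideal G) f)
      = Ideal.Quotient.mk (C0Ideal G) (rightTranslate g f) := rfl

/-- The action of `G` on `C_b^{ru}(G) / C_0(G)` induced by `R`. -/
def actionRQuot : GCStarAction G (CbruModC0 G) where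
  act :=
    { toFun := fun g =>
        { toFun := quotientTranslate g
          invFun := quotientTranslate g⁻¹
          left_inv := fun x => by
            obtain ⟨f, rfl⟩ := Ideal.Quotient.mk_surjective x
            rw [quotientTranslate_mk, quotientTranslate_mk, ← rightTranslate_mul, inv_mul_cancel,
              rightTranslate_one]
          right_inv := fun x => by
            obtain ⟨f, rfl⟩ := Ideal.Quotient.mk_surjective x
            rw [quotientTranslate_mk, quotientTranslate_mk, ← rightTranslate_mul, mul_inv_cancel,
              rightTranslate_one]
          map_mul' := map_mul _
          map_add' := map_add _
          map_star' := fun x => by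
            obtain ⟨f, rfl⟩ := Ideal.Quotient.mk_surjective x
            rfl
          map_smul' := fun z x => by
            obtain ⟨f, rfl⟩ := Ideal.Quotient.mk_surjective x
            rfl }
      map_one' := by
        ext x : 1
        obtain ⟨f, rfl⟩ := Ideal.Quotient.mk_surjective x
        exact congrArg _ (rightTranslate_one f)
      map_mul' := fun g h => by
        ext x : 1
        obtain ⟨f, rfl⟩ := Ideal.Quotient.mk_surjective x
        exact congrArg _ (rightTranslate_mul g h f) }
  continuous_orbit x := by
    obtain ⟨f, rfl⟩ := Ideal.Quotient.mk_surjective x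
    exact (continuous_starHom (quotientHom (G := G))).comp (actionR.continuous_orbit f)

end Cbru

/-! ### The covariant representation `(M, ρ)` -/

/-- `f` as a function with values in the (scalar) operators on `ℂ`. -/
def scalarHom : Cbru G →⋆ₙₐ[ℂ] (G →ᵇ (ℂ →L[ℂ] ℂ)) where
  toFun f := BoundedContinuousFunction.ofNormedAddCommGroup
    (fun x => f.1 x • ContinuousLinearMap.id ℂ ℂ) (f.1.continuous.smul continuous_const) ‖f.1‖
    (fun x => by
      rw [norm_smul, ContinuousLinearMap.norm_id, mul_one]
      exact f.1.norm_coe_le_norm x)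
  map_smul' z f := BoundedContinuousFunction.ext fun x =>
    mul_smul z (f.1 x) (ContinuousLinearMap.id ℂ ℂ)
  map_zero' := BoundedContinuousFunction.ext fun x => zero_smul ℂ (ContinuousLinearMap.id ℂ ℂ)
  map_add' f f' := BoundedContinuousFunction.ext fun x =>
    add_smul (f.1 x) (f'.1 x) (ContinuousLinearMap.id ℂ ℂ)
  map_mul' f f' := by
    refine BoundedContinuousFunction.ext fun x => ?_
    ext
    change (f.1 x * f'.1 x) • (1 : ℂ) = f.1 x • (f'.1 x • (1 : ℂ))
    rw [mul_smul]
  map_star' f := by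
    refine BoundedContinuousFunction.ext fun x => ?_
    change star (f.1 x) • ContinuousLinearMap.id ℂ ℂ = star (f.1 x • (1 : ℂ →L[ℂ] ℂ))
    rw [star_smul, star_one]
    rfl

section MRho
variable (μ : Measure G) [μ.IsHaarMeasure] [μ.Regular]

/-- The multiplication representation `(M(f) ξ)(x) = f(x) ξ(x)` on `L²(G)`. -/
def mulRep : Cbru G →⋆ₙₐ[ℂ] (Lp ℂ 2 μ →L[ℂ] Lp ℂ 2 μ) := (mulOp μ).comp scalarHom

theorem mulRep_ae (f : Cbru G) (ξ : Lp ℂ 2 μ) : mulRep μ f ξ =ᵐ[μ] fun x => f.1 x * ξ x :=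
  mulOp_ae μ (scalarHom f) ξ

/-- The covariant representation `(M, ρ)` of `(C_b^{ru}(G), G, R)` on `L²(G)`. -/
def MRho : CovariantRep (actionR (G := G)) (Lp ℂ 2 μ) where
  rep := mulRep μ
  uni := unitaryHom (rightTranslation μ) (norm_rightTranslation μ)
  continuous_uni := continuous_rightTranslation μ
  covariant g f := by
    have key : rightTranslation μ g * mulRep μ f
        = mulRep μ (actionR.act g f) * rightTranslation μ g := by
      ext ξ : 1
      ext1
      simp only [mul_apply_eq_comp]
      filter_upwards [rightTranslation_ae μ g (mulRep μ f ξ),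
        (quasiMeasurePreserving_mul_right μ g).ae (mulRep_ae μ f ξ),
        mulRep_ae μ (actionR.act g f) (rightTranslation μ g ξ),
        rightTranslation_ae μ g ξ] with x h1 h2 h3 h4
      rw [h1, h2, h3, h4, actionR_apply]
      ring
    have hu := (mem_unitary_of_isometric (rightTranslation μ) (norm_rightTranslation μ) g).2
    change rightTranslation μ g * mulRep μ f * star (rightTranslation μ g) = _
    rw [key, mul_assoc, hu, mul_one]

end MRho

end Main

/-! ### Metric lattices, the uniform Roe algebra and ghosts -/

/-- A metric lattice in `X`: a uniformly discrete subset `Z` such that the closed balls of some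
fixed radius `R` centred in `Z` cover `X`. -/
def IsMetricLattice {X : Type*} [MetricSpace X] (Z : Set X) : Prop :=
  (∃ δ > 0, ∀ z ∈ Z, ∀ w ∈ Z, z ≠ w → δ < dist z w) ∧ ∃ R > 0, ∀ x, ∃ z ∈ Z, dist x z ≤ R

/-- Uniform local finiteness: for each `S > 0` the closed balls of radius `S` have uniformly
bounded finite cardinality. -/
def UniformlyLocallyFinite (Z : Type*) [MetricSpace Z] : Prop :=
  ∀ S > 0, ∃ N : ℕ, ∀ z : Z, (Metric.closedBall z S).encard ≤ N

section Roe
variable (Z : Type*)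

/-- The Hilbert space `ℓ²(Z)`. -/
abbrev EllTwo : Type _ := lp (fun _ : Z => ℂ) 2

variable {Z}

open Classical in
/-- The basis vector `δ_z` of `ℓ²(Z)`. -/
def basisVec (z : Z) : EllTwo Z := lp.single 2 z (1 : ℂ)

theorem inner_basisVec (z : Z) (ξ : EllTwo Z) : inner ℂ (basisVec z) ξ = ξ z := by
  classical
  have := lp.inner_single_left (𝕜 := ℂ) z (1 : ℂ) ξ
  simpa [basisVec] using! this

/-- The matrix coefficient `a_{x,y} = ⟨a δ_y, δ_x⟩` (linear in the first variable). -/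
def matrixCoeff (a : EllTwo Z →L[ℂ] EllTwo Z) (x y : Z) : ℂ := inner ℂ (basisVec x) (a (basisVec y))

theorem matrixCoeff_star (a : EllTwo Z →L[ℂ] EllTwo Z) (x y : Z) :
    matrixCoeff (star a) x y = (starRingEnd ℂ) (matrixCoeff a y x) := by
  rw [matrixCoeff, matrixCoeff, ContinuousLinearMap.star_eq_adjoint,
    ContinuousLinearMap.adjoint_inner_right, inner_conj_symm]

theorem matrixCoeff_mul (a b : EllTwo Z →L[ℂ] EllTwo Z) (x y : Z) :
    matrixCoeff (a * b) x y = ∑' z, matrixCoeff a x z * matrixCoeff b z y := by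
  have h1 : matrixCoeff (a * b) x y = inner ℂ ((star a) (basisVec x)) (b (basisVec y)) := by
    rw [ContinuousLinearMap.star_eq_adjoint, ContinuousLinearMap.adjoint_inner_left]
    rfl
  rw [h1, lp.inner_eq_tsum]
  refine tsum_congr fun z => ?_
  rw [RCLike.inner_apply, ← inner_basisVec z, ← inner_basisVec z]
  change matrixCoeff b z y * (starRingEnd ℂ) (matrixCoeff (star a) z x) = _
  rw [matrixCoeff_star, Complex.conj_conj, mul_comm]

variable (Z) [MetricSpace Z]

/-- The *-algebra `⋃_R E_R` of bounded operators on `ℓ²(Z)` of finite propagation. -/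
def finitePropagation : StarSubalgebra ℂ (EllTwo Z →L[ℂ] EllTwo Z) where
  carrier := {a | ∃ R : ℝ, ∀ x y, matrixCoeff a x y ≠ 0 → dist x y ≤ R}
  mul_mem' := by
    rintro a b ⟨R, hR⟩ ⟨S, hS⟩
    refine ⟨R + S, fun x y hxy => ?_⟩
    rw [matrixCoeff_mul] at hxy
    obtain ⟨z, hz⟩ : ∃ z, matrixCoeff a x z * matrixCoeff b z y ≠ 0 := by
      by_contra hcon
      push Not at hcon
      exact hxy (by simp [hcon])
    exact (dist_triangle x z y).trans
      (add_le_add (hR _ _ (left_ne_zero_of_mul hz)) (hS _ _ (right_ne_zero_of_mul hz)))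
  add_mem' := by
    rintro a b ⟨R, hR⟩ ⟨S, hS⟩
    refine ⟨max R S, fun x y hxy => ?_⟩
    have h : matrixCoeff (a + b) x y = matrixCoeff a x y + matrixCoeff b x y := by
      simp [matrixCoeff]
    by_cases ha : matrixCoeff a x y = 0
    · exact le_max_of_le_right (hS x y fun hb => hxy (by rw [h, ha, hb, add_zero]))
    · exact le_max_of_le_left (hR x y ha)
  algebraMap_mem' := by
    intro r
    refine ⟨0, fun x y hxy => ?_⟩
    by_contra hd
    refine hxy ?_
    have hne : x ≠ y := fun h => hd (by simp [h])
    have h0 : inner ℂ (basisVec x) (basisVec y) = (0 : ℂ) := by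
      classical
      rw [inner_basisVec, basisVec, lp.single_apply_ne _ _ _ hne]
    simp [matrixCoeff, Algebra.algebraMap_eq_smul_one, h0]
  star_mem' := by
    rintro a ⟨R, hR⟩
    refine ⟨R, fun x y hxy => ?_⟩
    rw [dist_comm]
    refine hR y x fun h => hxy ?_
    rw [matrixCoeff_star, h, map_zero]

/-- The uniform Roe algebra `C*_u(Z)`. -/
def uniformRoe : StarSubalgebra ℂ (EllTwo Z →L[ℂ] EllTwo Z) :=
  (finitePropagation Z).topologicalClosure

/-- The ghost ideal `G*(Z)`: the elements `a` of `C*_u(Z)` with `a_{x,y} → 0` as `x, y → ∞`. -/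
def ghosts : Set (uniformRoe Z) :=
  {a | Tendsto (fun p : Z × Z => matrixCoeff (a : EllTwo Z →L[ℂ] EllTwo Z) p.1 p.2)
    (Bornology.cobounded Z ×ˢ Bornology.cobounded Z) (𝓝 0)}

end Roe

/-! ### The isometry `W : ℓ²(Z) → L²(G)` -/

section Embedding
variable {G : Type*} [Group G] [MetricSpace G] [ProperSpace G] [IsTopologicalGroup G]
  [IsIsometricSMul G G] [MeasurableSpace G] [BorelSpace G]

/-- A separation constant `δ` of `Z ⊆ G` together with a nonnegative `φ ∈ C_c(G)` supported in the
closed ball `B(e, δ/4)` and of norm one in `L²(G)`. -/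
structure LatticeBump (μ : Measure G) (Z : Set G) where
  /-- separation constant -/
  δ : ℝ
  δ_pos : 0 < δ
  separated : ∀ z ∈ Z, ∀ w ∈ Z, z ≠ w → δ ≤ dist z w
  /-- the bump function -/
  φ : C_c(G, ℝ)
  φ_nonneg : ∀ x, 0 ≤ φ x
  φ_support : tsupport φ ⊆ Metric.closedBall 1 (δ / 4)
  φ_norm : ∫ x, φ x ^ 2 ∂μ = 1

namespace LatticeBump
variable {μ : Measure G} [μ.IsHaarMeasure] {Z : Set G} (b : LatticeBump μ Z)

theorem memLp_translate (z : G) : MemLp (fun x => (b.φ (z⁻¹ * x) : ℂ)) 2 μ := by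
  refine Continuous.memLp_of_hasCompactSupport ?_ ?_
  · exact Complex.continuous_ofReal.comp (b.φ.continuous.comp (by fun_prop))
  · exact (b.φ.hasCompactSupport.comp_homeomorph (Homeomorph.mulLeft z⁻¹)).comp_left
      (g := fun r : ℝ => (r : ℂ)) Complex.ofReal_zero

/-- The translate `φ_z(x) = φ(z⁻¹ x)` as an element of `L²(G)`. -/
def translate (z : Z) : Lp ℂ 2 μ := (b.memLp_translate (z : G)).toLp _

theorem orthonormal_translate : Orthonormal ℂ b.translate := by
  classical
  rw [orthonormal_iff_ite]
  intro z w
  have h1 : inner ℂ (b.translate z) (b.translate w)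
      = ∫ x, ((b.φ ((z : G)⁻¹ * x) * b.φ ((w : G)⁻¹ * x) : ℝ) : ℂ) ∂μ := by
    rw [L2.inner_def]
    refine integral_congr_ae ?_
    filter_upwards [(b.memLp_translate (z : G)).coeFn_toLp,
      (b.memLp_translate (w : G)).coeFn_toLp] with x hz hw
    rw [translate, translate, hz, hw, RCLike.inner_apply, Complex.conj_ofReal]
    push_cast
    ring
  rw [h1]
  split_ifs with h
  · subst h
    have := integral_mul_left_eq_self (μ := μ) (fun x => b.φ x ^ 2) (z : G)⁻¹
    rw [integral_complex_ofReal]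
    simp only [← sq]
    rw [this, b.φ_norm, Complex.ofReal_one]
  · refine integral_eq_zero_of_ae (Eventually.of_forall fun x => ?_)
    by_contra hne
    have hd : ∀ u : G, b.φ (u⁻¹ * x) ≠ 0 → dist x u ≤ b.δ / 4 := fun u hu => by
      have := b.φ_support (subset_tsupport _ hu)
      rw [Metric.mem_closedBall] at this
      calc dist x u = dist (u⁻¹ • x) (u⁻¹ • u) := (dist_smul u⁻¹ x u).symm
        _ ≤ b.δ / 4 := by simpa using this
    have hz : b.φ ((z : G)⁻¹ * x) ≠ 0 := fun h0 => hne (by simp [h0])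
    have hw : b.φ ((w : G)⁻¹ * x) ≠ 0 := fun h0 => hne (by simp [h0])
    have h2 := b.separated z z.2 w w.2 fun h' => h (Subtype.ext h')
    have h3 := dist_triangle_left (z : G) (w : G) x
    linarith [hd z hz, hd w hw, b.δ_pos]

/-- The linear isometry `W : ℓ²(Z) → L²(G)` with `W δ_z = φ_z`. -/
def W : EllTwo Z →ₗᵢ[ℂ] Lp ℂ 2 μ := b.orthonormal_translate.orthogonalFamily.linearIsometry

theorem W_basisVec (z : Z) : b.W (basisVec z) = b.translate z := by
  let _ : DecidableEq Z := Classical.decEq Z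
  have h := b.orthonormal_translate.orthogonalFamily.linearIsometry_apply_single (i := z) (1 : ℂ)
  rw [LinearIsometry.toSpanSingleton_apply, one_smul] at h
  exact h

/-- The operator `W T W^*` on `L²(G)`. -/
def conj (T : EllTwo Z →L[ℂ] EllTwo Z) : Lp ℂ 2 μ →L[ℂ] Lp ℂ 2 μ :=
  b.W.toContinuousLinearMap ∘L T ∘L ContinuousLinearMap.adjoint b.W.toContinuousLinearMap

end LatticeBump
end Embedding

end

/-!
For `f ∈ C_c(G, C_b^{ru}(G))` and a representation `π` of the coefficients, the matrix coefficients
of the regular representation against elementary tensors are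

  `⟨ψ ⊗ k, (π_R ⋊ λ)(f) (φ ⊗ h)⟩ = ⟨k, π(a) h⟩`,   `a = ∫∫ conj(ψ(t)) φ(s⁻¹ t) R_{t⁻¹}(f(s)) dt ds`,

with `a ∈ C_b^{ru}(G)` independent of `π` (`inner_regularRep_tensorLp`). The value of `a` at a point
`x` of `G` is a matrix coefficient of `M ⋊ ρ`, namely `a(x) = ⟨V_x ψ, (M ⋊ ρ)(f) V_x φ⟩` for the
isometries `(V_x φ)(y) = Δ(x⁻¹ y)^{-1/2} φ(y⁻¹ x)` (`coefficient_apply`). Everything about reduced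
norms follows from these two formulas.

* If `π` is faithful it is isometric, so `|a(x)| ≤ ‖a‖ = ‖π(a)‖` is bounded by the reduced norm of
  `f`; taking `x = e` gives `‖(M ⋊ ρ)(f)‖ ≤ ‖(π_R ⋊ λ)(f)‖` (`norm_MRho_le_norm_regularRep`).
* For arbitrary `π`, `‖π(a)‖ ≤ ‖a‖ = sup_x |a(x)|` bounds each matrix coefficient of `(π_R ⋊ λ)(f)`
  on finite sums of elementary tensors by a multiple of `‖(M ⋊ ρ)(f)‖`. The constant depends on the
  vectors, but applying this to the powers `(f^* f)^{2^k}` and extracting roots removes it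
  (`norm_apply_le_of_moments`), so that `‖(π_R ⋊ λ)(f)‖ ≤ ‖(M ⋊ ρ)(f)‖`
  (`norm_regularRep_le_norm_MRho`).

The two inequalities make `M ⋊_r ρ` well defined and isometric. The second one, for the pullback of
`σ` to `C_b^{ru}(G)`, yields the quotient map `q_r`.

For the embedding, let `v(x) = ∑_z φ_z(x) δ_z ∈ ℓ²(Z)`, a bounded uniformly continuous function of
`x`. The operator `W T W^*` has the kernel `⟨v(x), T v(y)⟩`; if `T` has finite propagation the
kernel is supported near the diagonal, and `W T W^* = (M ⋊ ρ)(f)` for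
`f(s)(x) = Δ(s)^{-1/2} ⟨v(x), T v(x s)⟩` (`LatticeBump.conj_eq_integratedForm`). By density `W T W^*`
lies in the image of `M ⋊_r ρ` for all `T ∈ C*_u(Z)`.

If `T` is a ghost, `⟨V_x ψ, W T W^* V_x φ⟩` is a sum of boundedly many terms containing entries
`T_{z,w}` with `z`, `w` near `x`, so it tends to zero as `x → ∞`
(`LatticeBump.tendsto_inner_conj_reflect`). Hence the coefficients `a` of an `f` approximating
`W T W^*` are close to `C_0(G)`, and its image over the quotient is small
(`eq_zero_of_tendsto_inner_reflect`).
-/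

noncomputable section

/-! ### An operator norm estimate from moments -/

section Moments
variable {H : Type*} [NormedAddCommGroup H] [InnerProductSpace ℂ H] [CompleteSpace H]

/-- If the moments `⟨ξ, S ^ 2 ^ k ξ⟩` of the positive operator `S = T^* T` grow at most like a
constant times `C ^ (2 * 2 ^ k)`, then the constant is irrelevant: iterating the Cauchy-Schwarz
inequality `⟨ξ, S ^ n ξ⟩² ≤ ‖ξ‖² ⟨ξ, S ^ (2 n) ξ⟩` and taking `2 ^ k`-th roots removes it. -/
theorem norm_apply_le_of_moments (T : H →L[ℂ] H) (ξ : H) {C K : ℝ} (hC : 0 ≤ C)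
    (h : ∀ k : ℕ, ‖inner ℂ ξ (((star T * T) ^ 2 ^ k) ξ)‖ ≤ K * (C ^ 2) ^ 2 ^ k) :
    ‖T ξ‖ ≤ C * ‖ξ‖ := by
  set S := star T * T with hS
  have hsa : star S = S := by simp [hS]
  set m : ℕ → ℝ := fun k => ‖inner ℂ ξ ((S ^ 2 ^ k) ξ)‖ with hm
  have hm0 : m 0 = ‖T ξ‖ ^ 2 := by
    have : inner ℂ ξ ((S ^ 2 ^ 0) ξ) = inner ℂ (T ξ) (T ξ) := by
      rw [pow_zero, pow_one, hS, mul_apply_eq_comp, ContinuousLinearMap.star_eq_adjoint,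
        ContinuousLinearMap.adjoint_inner_right]
    rw [hm]
    simp only [this, inner_self_eq_norm_sq_to_K]
    simp
  have hstep : ∀ k, m k ^ 2 ≤ ‖ξ‖ ^ 2 * m (k + 1) := by
    intro k
    have h1 : inner ℂ ξ ((S ^ 2 ^ (k + 1)) ξ) = inner ℂ ((S ^ 2 ^ k) ξ) ((S ^ 2 ^ k) ξ) := by
      have h2 : star (S ^ 2 ^ k) = S ^ 2 ^ k := by rw [star_pow, hsa]
      rw [pow_succ, pow_mul, pow_two, mul_apply_eq_comp]
      nth_rewrite 1 [← h2]
      rw [ContinuousLinearMap.star_eq_adjoint, ContinuousLinearMap.adjoint_inner_right]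
    have h3 : m (k + 1) = ‖(S ^ 2 ^ k) ξ‖ ^ 2 := by
      simp only [hm, h1, inner_self_eq_norm_sq_to_K]
      simp
    rw [h3, ← mul_pow]
    exact pow_le_pow_left₀ (norm_nonneg _) (norm_inner_le_norm _ _) 2
  rcases eq_or_lt_of_le (norm_nonneg ξ) with h0 | hpos
  · have : ξ = 0 := norm_eq_zero.1 h0.symm
    simp [this]
  have hpow : ∀ k, m 0 ^ 2 ^ k * ‖ξ‖ ^ 2 ≤ (‖ξ‖ ^ 2) ^ 2 ^ k * m k := by
    intro k
    induction k with
    | zero => simp [mul_comm]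
    | succ k ih =>
      have h4 : (m 0 ^ 2 ^ k * ‖ξ‖ ^ 2) ^ 2 ≤ ((‖ξ‖ ^ 2) ^ 2 ^ k * m k) ^ 2 :=
        pow_le_pow_left₀ (by positivity) ih 2
      have h5 : ((‖ξ‖ ^ 2) ^ 2 ^ k * m k) ^ 2 ≤ (‖ξ‖ ^ 2) ^ 2 ^ (k + 1) * (‖ξ‖ ^ 2 * m (k + 1)) := by
        rw [mul_pow, ← pow_mul, ← pow_succ]
        exact mul_le_mul_of_nonneg_left (hstep k) (by positivity)
      have h6 := h4.trans h5
      rw [mul_pow, ← pow_mul, ← pow_succ] at h6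
      refine le_of_mul_le_mul_right ?_ (show 0 < ‖ξ‖ ^ 2 by positivity)
      linarith
  by_contra hlt
  rw [not_le] at hlt
  have hr : (C * ‖ξ‖) ^ 2 < m 0 := by
    rw [hm0]; exact pow_lt_pow_left₀ hlt (by positivity) two_ne_zero
  have hbd : ∀ k, m 0 ^ 2 ^ k * ‖ξ‖ ^ 2 ≤ K * ((C * ‖ξ‖) ^ 2) ^ 2 ^ k := by
    intro k
    refine (hpow k).trans ((mul_le_mul_of_nonneg_left (h k) (by positivity)).trans_eq ?_)
    rw [mul_pow C, mul_pow (C ^ 2)]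
    ring
  set r := (C * ‖ξ‖) ^ 2 with hrdef
  have hr0 : 0 ≤ r := by positivity
  have hm0pos : 0 < m 0 := hr0.trans_lt hr
  have hlim : Tendsto (fun k : ℕ => K * (r / m 0) ^ 2 ^ k) atTop (𝓝 (K * 0)) :=
    ((tendsto_pow_atTop_nhds_zero_of_lt_one (by positivity) ((div_lt_one hm0pos).2 hr)).comp
      (tendsto_pow_atTop_atTop_of_one_lt one_lt_two)).const_mul K
  have : ‖ξ‖ ^ 2 ≤ K * 0 := by
    refine ge_of_tendsto' hlim fun k => ?_
    rw [div_pow, mul_div_assoc', le_div_iff₀ (by positivity)]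
    linarith [hbd k]
  nlinarith [sq_pos_of_pos hpos]

end Moments

section Main

variable {G : Type*} [Group G] [TopologicalSpace G] [IsTopologicalGroup G]
  [LocallyCompactSpace G] [SecondCountableTopology G] [MeasurableSpace G] [BorelSpace G]

/-! ### Homomorphisms between crossed products from norm inequalities -/

namespace CovariantRep
variable {A : Type*} [NonUnitalCStarAlgebra A] {α : GCStarAction G A}
  {H : Type*} [NormedAddCommGroup H] [InnerProductSpace ℂ H] [CompleteSpace H]
  {K : Type*} [NormedAddCommGroup K] [InnerProductSpace ℂ K] [CompleteSpace K]
  (c : CovariantRep α H) (d : CovariantRep α K) (μ : Measure G) [μ.IsHaarMeasure] [μ.Regular]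

/-- The integrated form as a linear map. -/
def integratedFormₗ : C_c(G, A) →ₗ[ℂ] (H →L[ℂ] H) where
  toFun := c.integratedForm μ
  map_add' := c.integratedForm_add μ
  map_smul' := c.integratedForm_smul μ

/-- The canonical map `C_c(G, A) → A ⋊_{(π,U)} G` as a linear map. -/
def ofCcₗ : C_c(G, A) →ₗ[ℂ] c.crossedProduct μ where
  toFun := c.ofCc μ
  map_add' f g := Subtype.ext (c.integratedForm_add μ f g)
  map_smul' z f := Subtype.ext (c.integratedForm_smul μ z f)

theorem ofCc_mul (f g : C_c(G, A)) : c.ofCc μ f * c.ofCc μ g = c.ofCc μ (α.conv μ f g) :=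
  Subtype.ext (c.integratedForm_mul μ f g)

theorem star_ofCc (f : C_c(G, A)) : star (c.ofCc μ f) = c.ofCc μ (α.involution f) :=
  Subtype.ext (c.integratedForm_star μ f)

theorem mem_crossedProduct_iff {T : H →L[ℂ] H} :
    T ∈ c.crossedProduct μ ↔ T ∈ closure (Set.range (c.integratedForm μ)) := Iff.rfl

theorem denseRange_ofCc : DenseRange (c.ofCc μ) := by
  intro x
  rw [Metric.mem_closure_iff]
  intro ε hε
  obtain ⟨_, ⟨f, rfl⟩, hf⟩ := Metric.mem_closure_iff.1 ((c.mem_crossedProduct_iff μ).1 x.2) ε hε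
  exact ⟨_, ⟨f, rfl⟩, hf⟩

theorem isClosed_crossedProduct : IsClosed (c.crossedProduct μ : Set (H →L[ℂ] H)) :=
  NonUnitalStarSubalgebra.isClosed_topologicalClosure _

theorem integratedForm_mem_crossedProduct (f : C_c(G, A)) :
    c.integratedForm μ f ∈ c.crossedProduct μ := (c.ofCc μ f).2

/-- A norm inequality between the integrated forms of two covariant representations induces a
*-homomorphism between the crossed products. The target is an arbitrary closed *-algebra `D`
containing the image of the second integrated form. -/
theorem exists_starHom_of_norm_le (D : NonUnitalStarSubalgebra ℂ (K →L[ℂ] K))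
    (hD : IsClosed (D : Set (K →L[ℂ] K))) (hmem : ∀ f, d.integratedForm μ f ∈ D)
    (hle : ∀ f, ‖d.integratedForm μ f‖ ≤ ‖c.integratedForm μ f‖) :
    ∃ j : c.crossedProduct μ →⋆ₙₐ[ℂ] D,
      (∀ f, (j (c.ofCc μ f) : K →L[ℂ] K) = d.integratedForm μ f) ∧ ∀ x, ‖j x‖ ≤ ‖x‖ := by
  let L : c.crossedProduct μ →L[ℂ] (K →L[ℂ] K) :=
    (d.integratedFormₗ μ).extendOfNorm (c.ofCcₗ μ)
  have hL0 : ∀ f, ‖d.integratedFormₗ μ f‖ ≤ 1 * ‖c.ofCcₗ μ f‖ := fun f => by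
    rw [one_mul]; exact hle f
  have hL : ∀ f, L (c.ofCc μ f) = d.integratedForm μ f :=
    LinearMap.extendOfNorm_eq (f := d.integratedFormₗ μ) (e := c.ofCcₗ μ)
      (c.denseRange_ofCc μ) ⟨1, hL0⟩
  have hLn : ∀ x, ‖L x‖ ≤ ‖x‖ := fun x => by
    simpa using LinearMap.norm_extendOfNorm_apply_le (f := d.integratedFormₗ μ)
      (e := c.ofCcₗ μ) (c.denseRange_ofCc μ) 1 hL0 x
  have hLD : ∀ x, L x ∈ D := fun x => by
    refine (c.denseRange_ofCc μ).induction_on x (hD.preimage L.continuous) fun f => ?_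
    rw [hL]
    exact hmem f
  have hmul : ∀ x y, L (x * y) = L x * L y := fun x y => by
    refine (c.denseRange_ofCc μ).induction_on₂
      (isClosed_eq (by fun_prop) (by fun_prop)) (fun f g => ?_) x y
    rw [ofCc_mul, hL, hL, hL, integratedForm_mul]
  have hstar : ∀ x, L (star x) = star (L x) := fun x => by
    have hs : Continuous (star : c.crossedProduct μ → c.crossedProduct μ) :=
      (continuous_subtype_val.star).subtype_mk _
    refine (c.denseRange_ofCc μ).induction_on x
      (isClosed_eq (L.continuous.comp hs) L.continuous.star) fun f => ?_
    rw [star_ofCc, hL, hL, integratedForm_star]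
  exact ⟨{
    toFun := fun x => ⟨L x, hLD x⟩
    map_smul' := fun z x => Subtype.ext (map_smul L z x)
    map_zero' := Subtype.ext (map_zero L)
    map_add' := fun x y => Subtype.ext (map_add L x y)
    map_mul' := fun x y => Subtype.ext (hmul x y)
    map_star' := fun x => Subtype.ext (hstar x) }, hL, hLn⟩

/-- If two integrated forms have the same norm, the crossed products are isomorphic. -/
theorem exists_inverse_starHoms_of_norm_eq
    (h : ∀ f, ‖d.integratedForm μ f‖ = ‖c.integratedForm μ f‖) :
    ∃ (j : c.crossedProduct μ →⋆ₙₐ[ℂ] d.crossedProduct μ)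
      (i : d.crossedProduct μ →⋆ₙₐ[ℂ] c.crossedProduct μ),
      (∀ f, j (c.ofCc μ f) = d.ofCc μ f) ∧ (∀ x, i (j x) = x) ∧ ∀ x, j (i x) = x := by
  obtain ⟨j, hj, hjn⟩ := c.exists_starHom_of_norm_le d μ (d.crossedProduct μ)
    (d.isClosed_crossedProduct μ) (d.integratedForm_mem_crossedProduct μ) fun f => (h f).le
  obtain ⟨i, hi, hin⟩ := d.exists_starHom_of_norm_le c μ (c.crossedProduct μ)
    (c.isClosed_crossedProduct μ) (c.integratedForm_mem_crossedProduct μ) fun f => (h f).ge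
  have hjc : Continuous j := AddMonoidHomClass.continuous_of_bound j 1 (by simpa using hjn)
  have hic : Continuous i := AddMonoidHomClass.continuous_of_bound i 1 (by simpa using hin)
  have hj' : ∀ f, j (c.ofCc μ f) = d.ofCc μ f := fun f => Subtype.ext (hj f)
  have hi' : ∀ f, i (d.ofCc μ f) = c.ofCc μ f := fun f => Subtype.ext (hi f)
  exact ⟨j, i, hj',
    fun x => (c.denseRange_ofCc μ).induction_on x
      (isClosed_eq (hic.comp hjc) continuous_id) fun f => by rw [hj', hi'],
    fun x => (d.denseRange_ofCc μ).induction_on x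
      (isClosed_eq (hjc.comp hic) continuous_id) fun f => by rw [hi', hj']⟩

/-- The powers `(f^* * f)^{2^k}` in the convolution algebra. -/
def _root_.GCStarAction.starMulPow (α : GCStarAction G A) (f : C_c(G, A)) : ℕ → C_c(G, A)
  | 0 => α.conv μ (α.involution f) f
  | k + 1 => α.conv μ (α.starMulPow f k) (α.starMulPow f k)

theorem integratedForm_starMulPow (f : C_c(G, A)) (k : ℕ) :
    c.integratedForm μ (α.starMulPow μ f k)
      = (star (c.integratedForm μ f) * c.integratedForm μ f) ^ 2 ^ k := by
  induction k with
  | zero =>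
    rw [pow_zero, pow_one, integratedForm_star, integratedForm_mul]
    rfl
  | succ k ih =>
    rw [pow_succ, pow_mul, pow_two, ← ih, integratedForm_mul]
    rfl

/-- If every matrix coefficient of `d ⋊ U` against vectors of a dense subspace is bounded by a
multiple of the norm of `c ⋊ U`, with a constant depending on the vectors, then the norm of `d ⋊ U`
is bounded by the norm of `c ⋊ U`. -/
theorem norm_integratedForm_le_of_dense (D : Submodule ℂ K) (hD : Dense (D : Set K))
    (h : ∀ ξ ∈ D, ∃ C : ℝ, ∀ f, ‖inner ℂ ξ (d.integratedForm μ f ξ)‖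
      ≤ C * ‖c.integratedForm μ f‖) (f : C_c(G, A)) :
    ‖d.integratedForm μ f‖ ≤ ‖c.integratedForm μ f‖ := by
  refine ContinuousLinearMap.opNorm_le_bound _ (norm_nonneg _) fun ξ => ?_
  refine hD.induction (P := fun ξ => ‖d.integratedForm μ f ξ‖ ≤ ‖c.integratedForm μ f‖ * ‖ξ‖)
    (fun ξ hξ => ?_) (isClosed_le (by fun_prop) (by fun_prop)) ξ
  obtain ⟨C, hC⟩ := h ξ hξ
  refine norm_apply_le_of_moments _ ξ (K := max C 0) (norm_nonneg _) fun k => ?_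
  rw [← integratedForm_starMulPow]
  refine (hC _).trans (mul_le_mul (le_max_left _ _) ?_ (norm_nonneg _) (le_max_right _ _))
  rw [integratedForm_starMulPow]
  refine (norm_pow_le' _ (by positivity)).trans (pow_le_pow_left₀ (norm_nonneg _) ?_ _)
  rw [CStarRing.norm_star_mul_self, sq]

end CovariantRep

/-! ### Elementary tensors in `L²(G, H)` -/

section Tensors
variable (μ : Measure G) [μ.IsHaarMeasure] [μ.Regular]
  {H : Type*} [NormedAddCommGroup H] [InnerProductSpace ℂ H] [CompleteSpace H]

theorem memLp_ccLp (φ : C_c(G, ℂ)) : MemLp φ 2 μ :=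
  φ.continuous.memLp_of_hasCompactSupport φ.hasCompactSupport

/-- A compactly supported continuous function as a vector of `L²(G)`. -/
def ccLp (φ : C_c(G, ℂ)) : Lp ℂ 2 μ := (memLp_ccLp μ φ).toLp φ

theorem ccLp_ae (φ : C_c(G, ℂ)) : ccLp μ φ =ᵐ[μ] φ := (memLp_ccLp μ φ).coeFn_toLp

theorem denseRange_ccLp : DenseRange (ccLp (G := G) μ) := by
  intro ξ
  rw [Metric.mem_closure_iff]
  intro ε hε
  obtain ⟨f, hfc, hfe, hf, hf2⟩ := (Lp.memLp ξ).exists_hasCompactSupport_eLpNorm_sub_le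
    (p := 2) (by simp) (ε := ENNReal.ofReal (ε / 2)) (by simpa using by positivity)
  refine ⟨_, ⟨⟨⟨f, hf⟩, hfc⟩, rfl⟩, ?_⟩
  have : ξ - ccLp μ ⟨⟨f, hf⟩, hfc⟩ = ((Lp.memLp ξ).sub hf2).toLp _ := by
    rw [MemLp.toLp_sub (Lp.memLp ξ) hf2, Lp.toLp_coeFn]
    rfl
  rw [dist_eq_norm, this, Lp.norm_toLp]
  exact (ENNReal.toReal_le_of_le_ofReal (by positivity) hfe).trans_lt (by linarith)

theorem inner_ccLp (φ ψ : C_c(G, ℂ)) :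
    inner ℂ (ccLp μ ψ) (ccLp μ φ) = ∫ x, (starRingEnd ℂ) (ψ x) * φ x ∂μ := by
  rw [L2.inner_def]
  refine integral_congr_ae ?_
  filter_upwards [ccLp_ae μ φ, ccLp_ae μ ψ] with x h1 h2
  rw [h1, h2, RCLike.inner_apply, mul_comm]

/-- The vector `t ↦ φ(t) h` of `L²(G, H)`. -/
def tensorLp (φ : C_c(G, ℂ)) (h : H) : Lp H 2 μ :=
  (ContinuousLinearMap.toSpanSingleton ℂ h).compLpL 2 μ (ccLp μ φ)

theorem tensorLp_ae (φ : C_c(G, ℂ)) (h : H) : tensorLp μ φ h =ᵐ[μ] fun t => φ t • h := by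
  filter_upwards [(ContinuousLinearMap.toSpanSingleton ℂ h).coeFn_compLpL (p := 2) (ccLp μ φ),
    ccLp_ae μ φ] with t h1 h2
  refine h1.trans ?_
  rw [h2]
  rfl

theorem norm_tensorLp_le (φ : C_c(G, ℂ)) (h : H) : ‖tensorLp μ φ h‖ ≤ ‖ccLp μ φ‖ * ‖h‖ := by
  rw [mul_comm]
  refine Lp.norm_le_mul_norm_of_ae_le_mul ?_
  filter_upwards [tensorLp_ae μ φ h, ccLp_ae μ φ] with t h1 h2
  rw [h1, h2, norm_smul, mul_comm]

theorem dense_span_tensorLp : Dense (Submodule.span ℂ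
    {ξ : Lp H 2 μ | ∃ φ h, ξ = tensorLp μ φ h} : Set (Lp H 2 μ)) := by
  set D := Submodule.span ℂ {ξ : Lp H 2 μ | ∃ φ h, ξ = tensorLp μ φ h} with hDdef
  have key : ∀ (h : H) (ξ : Lp ℂ 2 μ), (ContinuousLinearMap.toSpanSingleton ℂ h).compLpL 2 μ ξ
      ∈ D.topologicalClosure := fun h ξ => by
    refine (denseRange_ccLp μ).induction_on ξ
      (D.isClosed_topologicalClosure.preimage (ContinuousLinearMap.continuous _)) fun φ => ?_
    exact D.le_topologicalClosure (Submodule.subset_span ⟨φ, h, rfl⟩)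
  intro ξ
  change ξ ∈ D.topologicalClosure
  refine Lp.induction (p := 2) (by simp) (motive := fun ξ => ξ ∈ D.topologicalClosure)
    ?_ ?_ D.isClosed_topologicalClosure ξ
  · intro h s hs hμs
    convert key h (indicatorConstLp 2 hs hμs.ne 1) using 1
    rw [Lp.simpleFunc.coe_indicatorConst]
    ext1
    filter_upwards [indicatorConstLp_coeFn (p := 2) (hs := hs) (hμs := hμs.ne) (c := h),
      indicatorConstLp_coeFn (p := 2) (hs := hs) (hμs := hμs.ne) (c := (1 : ℂ)),
      (ContinuousLinearMap.toSpanSingleton ℂ h).coeFn_compLpL (p := 2)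
        (indicatorConstLp 2 hs hμs.ne (1 : ℂ))] with t h1 h2 h3
    rw [h1, h3, h2]
    by_cases ht : t ∈ s <;> simp [ht]
  · intro f g hf hg _ h1 h2
    exact add_mem h1 h2

theorem eq_zero_of_inner_tensorLp {T : Lp H 2 μ →L[ℂ] Lp H 2 μ}
    (hT : ∀ φ ψ h k, inner ℂ (tensorLp μ ψ k) (T (tensorLp μ φ h)) = 0) : T = 0 := by
  have hdense := dense_span_tensorLp (H := H) μ
  refine ContinuousLinearMap.ext_on hdense ?_
  rintro _ ⟨φ, h, rfl⟩
  change _ = (0 : Lp H 2 μ)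
  refine hdense.eq_zero_of_inner_right ℂ fun η hη => ?_
  induction hη using Submodule.span_induction with
  | mem η hη =>
    obtain ⟨ψ, k, rfl⟩ := hη
    exact hT φ ψ h k
  | zero => exact inner_zero_left _
  | add η₁ η₂ _ _ h1 h2 => rw [inner_add_left, h1, h2, add_zero]
  | smul z η _ h1 => rw [inner_smul_left, h1, mul_zero]

/-- An operator on `L²(G)` is bounded by `C` if its sesquilinear form is so on `C_c(G)`. -/
theorem opNorm_le_of_inner_ccLp (T : Lp ℂ 2 μ →L[ℂ] Lp ℂ 2 μ) {C : ℝ} (hC : 0 ≤ C)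
    (h : ∀ φ ψ, ‖inner ℂ (ccLp μ ψ) (T (ccLp μ φ))‖ ≤ C * ‖ccLp μ φ‖ * ‖ccLp μ ψ‖) :
    ‖T‖ ≤ C := by
  refine ContinuousLinearMap.opNorm_le_bound _ hC fun ξ => ?_
  have h1 : ∀ ξ η, ‖inner ℂ η (T ξ)‖ ≤ C * ‖ξ‖ * ‖η‖ := fun ξ η =>
    (denseRange_ccLp μ).induction_on₂ (p := fun ξ η => ‖inner ℂ η (T ξ)‖ ≤ C * ‖ξ‖ * ‖η‖)
      (isClosed_le (by fun_prop) (by fun_prop)) (fun φ ψ => h φ ψ) ξ η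
  have h2 := h1 ξ (T ξ)
  rw [inner_self_eq_norm_sq_to_K] at h2
  rcases eq_or_lt_of_le (norm_nonneg (T ξ)) with h0 | hpos
  · rw [← h0]; positivity
  · have h3 : ‖T ξ‖ * ‖T ξ‖ ≤ C * ‖ξ‖ * ‖T ξ‖ := by simpa [sq] using h2
    exact le_of_mul_le_mul_right h3 hpos

theorem eq_of_inner_ccLp {S T : Lp ℂ 2 μ →L[ℂ] Lp ℂ 2 μ}
    (h : ∀ φ ψ, inner ℂ (ccLp μ ψ) (S (ccLp μ φ)) = inner ℂ (ccLp μ ψ) (T (ccLp μ φ))) :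
    S = T := by
  have := opNorm_le_of_inner_ccLp μ (S - T) le_rfl fun φ ψ => by
    simp [inner_sub_right, h]
  exact sub_eq_zero.1 (norm_le_zero_iff.1 this)

end Tensors
end Main

section Main

variable {G : Type*} [Group G] [TopologicalSpace G] [IsTopologicalGroup G]
  [LocallyCompactSpace G] [SecondCountableTopology G] [MeasurableSpace G] [BorelSpace G]

/-! ### Matrix coefficients of the regular representation -/

section Coefficient
variable {A : Type*} [NonUnitalCStarAlgebra A] (α : GCStarAction G A)
  (μ : Measure G) [μ.IsHaarMeasure] [μ.Regular]

/-- The coefficient `∫∫ conj(ψ(t)) φ(s⁻¹ t) α_{t⁻¹}(f(s)) dt ds`, an element of `A`. It is the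
`A`-valued inner product of `ψ` with the image of `φ` under `f` acting on the Hilbert module
`L²(G, A)`. -/
def coefficient (φ ψ : C_c(G, ℂ)) (f : C_c(G, A)) : A :=
  ∫ s, ∫ t, ((starRingEnd ℂ) (ψ t) * φ (s⁻¹ * t)) • α.act t⁻¹ (f s) ∂μ ∂μ

theorem map_coefficient (φ ψ : C_c(G, ℂ)) (f : C_c(G, A)) (L : A →L[ℂ] ℂ) :
    L (coefficient α μ φ ψ f)
      = ∫ s, ∫ t, (starRingEnd ℂ) (ψ t) * φ (s⁻¹ * t) * L (α.act t⁻¹ (f s)) ∂μ ∂μ := by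
  have hc : Continuous (fun p : G × G =>
      ((starRingEnd ℂ) (ψ p.2) * φ (p.1⁻¹ * p.2)) • α.act p.2⁻¹ (f p.1)) := by
    have h1 : Continuous fun p : G × G => (starRingEnd ℂ) (ψ p.2) :=
      RCLike.continuous_conj.comp (ψ.continuous.comp continuous_snd)
    have h2 : Continuous fun p : G × G => φ (p.1⁻¹ * p.2) := φ.continuous.comp (by fun_prop)
    exact (h1.mul h2).smul (α.continuous_comp_act (by fun_prop) (f.continuous.comp continuous_fst))
  have hi : ∀ s, Integrable
      (fun t => ((starRingEnd ℂ) (ψ t) * φ (s⁻¹ * t)) • α.act t⁻¹ (f s)) μ := fun s =>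
    Continuous.integrable_of_hasCompactSupport (hc.comp (by fun_prop : Continuous fun t => (s, t)))
      (HasCompactSupport.intro ψ.hasCompactSupport.isCompact fun t ht => by
        simp [image_eq_zero_of_notMem_tsupport ht])
  have ho : Integrable
      (fun s => ∫ t, ((starRingEnd ℂ) (ψ t) * φ (s⁻¹ * t)) • α.act t⁻¹ (f s) ∂μ) μ := by
    refine Continuous.integrable_of_hasCompactSupport ?_ ?_
    · refine continuousOn_univ.1 (continuousOn_integral_of_compact_support (μ := μ) (s := Set.univ)
        (f := fun s t => ((starRingEnd ℂ) (ψ t) * φ (s⁻¹ * t)) • α.act t⁻¹ (f s))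
        ψ.hasCompactSupport.isCompact hc.continuousOn ?_)
      intro s t _ ht
      simp [image_eq_zero_of_notMem_tsupport ht]
    · exact HasCompactSupport.intro f.hasCompactSupport.isCompact fun s hs => by
        simp [image_eq_zero_of_notMem_tsupport hs]
  rw [coefficient, ← L.integral_comp_comm ho]
  refine integral_congr_ae (Eventually.of_forall fun s => ?_)
  simp only []
  rw [← L.integral_comp_comm (hi s)]
  simp only [map_smul, smul_eq_mul]

variable {H : Type*} [NormedAddCommGroup H] [InnerProductSpace ℂ H] [CompleteSpace H]

/-- Matrix coefficients of the regular representation induced by `π` against elementary tensors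
are matrix coefficients of `π` itself. -/
theorem inner_regularRep_tensorLp (π : A →⋆ₙₐ[ℂ] (H →L[ℂ] H)) (φ ψ : C_c(G, ℂ)) (h k : H)
    (f : C_c(G, A)) :
    inner ℂ (tensorLp μ ψ k) ((regularRep α π μ).integratedForm μ f (tensorLp μ φ h))
      = inner ℂ k (π (coefficient α μ φ ψ f) h) := by
  let L : A →L[ℂ] ℂ := (innerSL ℂ k).comp ((ContinuousLinearMap.apply ℂ H h).comp
    (⟨(π : A →ₗ[ℂ] (H →L[ℂ] H)), continuous_starHom π⟩ : A →L[ℂ] (H →L[ℂ] H)))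
  have hL : ∀ a, L a = inner ℂ k (π a h) := fun _ => rfl
  rw [← hL, map_coefficient, CovariantRep.integratedForm_apply]
  refine (integral_inner ((regularRep α π μ).integrable_integrand μ f (tensorLp μ φ h))
    (tensorLp μ ψ k)).symm.trans ?_
  refine integral_congr_ae (Eventually.of_forall fun s => ?_)
  simp only [L2.inner_def]
  refine integral_congr_ae ?_
  filter_upwards [tensorLp_ae μ ψ k,
    mulOp_ae μ (orbitHom α π (f s)) (leftTranslation μ s (tensorLp μ φ h)),
    leftTranslation_ae μ s (tensorLp μ φ h),
    (measurePreserving_mul_left μ s⁻¹).quasiMeasurePreserving.ae (tensorLp_ae μ φ h)]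
    with t h1 h2 h3 h4
  change inner ℂ (tensorLp μ ψ k t)
    (mulOp μ (orbitHom α π (f s)) (leftTranslation μ s (tensorLp μ φ h)) t) = _
  rw [h1, h2, h3, h4, orbitHom_apply, map_smul, inner_smul_left, inner_smul_right, hL]
  ring

end Coefficient

/-! ### Evaluation of coefficients at points of the group -/

section Evaluation
variable (μ : Measure G) [μ.IsHaarMeasure] [μ.Regular]

/-- Evaluation at `x` on `C_b^{ru}(G)`. -/
def evalCbru (x : G) : Cbru G →L[ℂ] ℂ :=
  LinearMap.mkContinuous
    { toFun := fun f => f.1 x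
      map_add' := fun _ _ => rfl
      map_smul' := fun _ _ => rfl } 1
    (fun f => by simpa using! f.1.norm_coe_le_norm x)

theorem inner_MRho_ccLp (φ ψ : C_c(G, ℂ)) (f : C_c(G, Cbru G)) :
    inner ℂ (ccLp μ ψ) ((MRho μ).integratedForm μ f (ccLp μ φ))
      = ∫ s, ∫ y, (starRingEnd ℂ) (ψ y) * ((f s).1 y *
          (((√(modularFn s) : ℝ) : ℂ) * φ (y * s))) ∂μ ∂μ := by
  rw [CovariantRep.integratedForm_apply]
  refine (integral_inner ((MRho μ).integrable_integrand μ f (ccLp μ φ))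
    (ccLp μ ψ)).symm.trans ?_
  refine integral_congr_ae (Eventually.of_forall fun s => ?_)
  simp only [L2.inner_def]
  refine integral_congr_ae ?_
  filter_upwards [ccLp_ae μ ψ, mulRep_ae μ (f s) (rightTranslation μ s (ccLp μ φ)),
    rightTranslation_ae μ s (ccLp μ φ),
    (quasiMeasurePreserving_mul_right μ s).ae (ccLp_ae μ φ)] with y h1 h2 h3 h4
  change inner ℂ (ccLp μ ψ y) (mulRep μ (f s) (rightTranslation μ s (ccLp μ φ)) y) = _
  rw [h1, h2, h3, h4, RCLike.inner_apply, mul_comm]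

theorem integral_inv_mul_modular (x : G) {F : G → ℂ} (hF : Continuous F)
    (hFc : HasCompactSupport F) :
    ∫ y, (modularFn (x⁻¹ * y))⁻¹ • F (y⁻¹ * x) ∂μ = ∫ t, F t ∂μ := by
  rw [← integral_inv_modular μ hF hFc,
    ← integral_mul_left_eq_self (fun y => (modularFn (x⁻¹ * y))⁻¹ • F (y⁻¹ * x)) x]
  simp

/-- The function `y ↦ Δ(x⁻¹ y)^{-1/2} φ(y⁻¹ x)`. On `L²(G)` this is the unitary which identifies
the regular representation induced by the evaluation at `x` with `(M, ρ)`. -/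
def reflect (x : G) (φ : C_c(G, ℂ)) : C_c(G, ℂ) where
  toFun y := (((√(modularFn (x⁻¹ * y)))⁻¹ : ℝ) : ℂ) * φ (y⁻¹ * x)
  continuous_toFun := by
    have h1 : Continuous fun y : G => √(modularFn (x⁻¹ * y)) :=
      (continuous_modularFn.comp (continuous_const.mul continuous_id)).sqrt
    have h2 : Continuous fun y : G => φ (y⁻¹ * x) := φ.continuous.comp (by fun_prop)
    exact (Complex.continuous_ofReal.comp
      (h1.inv₀ fun y => (Real.sqrt_pos.2 (modularFn_pos _)).ne')).mul h2
  hasCompactSupport' :=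
    (φ.hasCompactSupport.comp_homeomorph
      ((Homeomorph.inv G).trans (Homeomorph.mulRight x))).mul_left

theorem reflect_apply (x : G) (φ : C_c(G, ℂ)) (y : G) :
    reflect x φ y = (((√(modularFn (x⁻¹ * y)))⁻¹ : ℝ) : ℂ) * φ (y⁻¹ * x) := rfl

theorem reflect_one_reflect_one (φ : C_c(G, ℂ)) : reflect 1 (reflect 1 φ) = φ := by
  ext y
  have h : (√(modularFn y))⁻¹ * (√(modularFn y⁻¹))⁻¹ = 1 := by
    rw [← mul_inv, ← Real.sqrt_mul (modularFn_pos y).le, ← modularFn_mul]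
    simp [modularFn_one]
  rw [reflect_apply, reflect_apply, ← mul_assoc, ← Complex.ofReal_mul]
  simp only [inv_one, one_mul, mul_one, inv_inv]
  rw [h]
  simp

theorem sqrt_inv_mul_self (g : G) :
    (((√(modularFn g))⁻¹ : ℝ) : ℂ) * (((√(modularFn g))⁻¹ : ℝ) : ℂ)
      = (((modularFn g)⁻¹ : ℝ) : ℂ) := by
  rw [← Complex.ofReal_mul, ← mul_inv, Real.mul_self_sqrt (modularFn_pos g).le]

theorem norm_ccLp_reflect (x : G) (φ : C_c(G, ℂ)) : ‖ccLp μ (reflect x φ)‖ = ‖ccLp μ φ‖ := by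
  have h : inner ℂ (ccLp μ (reflect x φ)) (ccLp μ (reflect x φ))
      = inner ℂ (ccLp μ φ) (ccLp μ φ) := by
    rw [inner_ccLp, inner_ccLp, ← integral_inv_mul_modular μ x
      (F := fun t => (starRingEnd ℂ) (φ t) * φ t)
      ((RCLike.continuous_conj.comp φ.continuous).mul φ.continuous)
      φ.hasCompactSupport.mul_left]
    refine integral_congr_ae (Eventually.of_forall fun y => ?_)
    simp only [reflect_apply, map_mul, Complex.conj_ofReal, Complex.real_smul]
    rw [← sqrt_inv_mul_self]
    ring
  have h' : ‖ccLp μ (reflect x φ)‖ ^ 2 = ‖ccLp μ φ‖ ^ 2 := by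
    rw [@norm_sq_eq_re_inner ℂ, @norm_sq_eq_re_inner ℂ, h]
  exact (sq_eq_sq₀ (norm_nonneg _) (norm_nonneg _)).1 h'

/-- The values of the coefficients in `C_b^{ru}(G)` are matrix coefficients of `M ⋊ ρ`. -/
theorem coefficient_apply (φ ψ : C_c(G, ℂ)) (f : C_c(G, Cbru G)) (x : G) :
    (coefficient actionR μ φ ψ f).1 x
      = inner ℂ (ccLp μ (reflect x ψ))
          ((MRho μ).integratedForm μ f (ccLp μ (reflect x φ))) := by
  refine (map_coefficient actionR μ φ ψ f (evalCbru x)).trans ?_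
  rw [inner_MRho_ccLp]
  refine integral_congr_ae (Eventually.of_forall fun s => ?_)
  change ∫ t, (starRingEnd ℂ) (ψ t) * φ (s⁻¹ * t) * (f s).1 (x * t⁻¹) ∂μ = _
  have hc : Continuous fun t => (starRingEnd ℂ) (ψ t) * φ (s⁻¹ * t) * (f s).1 (x * t⁻¹) := by
    have h1 : Continuous fun t => (starRingEnd ℂ) (ψ t) :=
      RCLike.continuous_conj.comp ψ.continuous
    have h2 : Continuous fun t => φ (s⁻¹ * t) := φ.continuous.comp (by fun_prop)
    have h3 : Continuous fun t => (f s).1 (x * t⁻¹) := (f s).1.continuous.comp (by fun_prop)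
    exact (h1.mul h2).mul h3
  rw [← integral_inv_mul_modular μ x hc (HasCompactSupport.intro ψ.hasCompactSupport.isCompact
    fun t ht => by simp [image_eq_zero_of_notMem_tsupport ht])]
  refine integral_congr_ae (Eventually.of_forall fun y => ?_)
  simp only [reflect_apply, map_mul, Complex.conj_ofReal, Complex.real_smul]
  have e1 : (((√(modularFn (x⁻¹ * (y * s))))⁻¹ : ℝ) : ℂ)
      = (((√(modularFn (x⁻¹ * y)))⁻¹ : ℝ) : ℂ) * (((√(modularFn s))⁻¹ : ℝ) : ℂ) := by
    rw [← mul_assoc, modularFn_mul, Real.sqrt_mul (modularFn_pos _).le, mul_inv,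
      Complex.ofReal_mul]
  have e2 : (((√(modularFn s))⁻¹ : ℝ) : ℂ) * ((√(modularFn s) : ℝ) : ℂ) = 1 := by
    rw [← Complex.ofReal_mul, inv_mul_cancel₀ (Real.sqrt_pos.2 (modularFn_pos s)).ne',
      Complex.ofReal_one]
  have e3 : s⁻¹ * (y⁻¹ * x) = (y * s)⁻¹ * x := by group
  have e4 : x * (y⁻¹ * x)⁻¹ = y := by group
  rw [e1, ← sqrt_inv_mul_self, e3, e4]
  linear_combination (-(((√(modularFn (x⁻¹ * y)))⁻¹ : ℝ) : ℂ) *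
    (((√(modularFn (x⁻¹ * y)))⁻¹ : ℝ) : ℂ) * (starRingEnd ℂ) (ψ (y⁻¹ * x)) *
    φ ((y * s)⁻¹ * x) * (f s).1 y) * e2

/-- The norm of `C_b^{ru}(G)` is computed by evaluations, and the reflections are isometric. -/
theorem norm_coefficient_le (φ ψ : C_c(G, ℂ)) (f : C_c(G, Cbru G)) :
    ‖coefficient actionR μ φ ψ f‖
      ≤ ‖ccLp μ ψ‖ * ‖ccLp μ φ‖ * ‖(MRho μ).integratedForm μ f‖ := by
  refine Cbru_norm_le (by positivity) fun x => ?_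
  rw [coefficient_apply]
  refine (norm_inner_le_norm _ _).trans ?_
  rw [norm_ccLp_reflect, mul_assoc]
  refine mul_le_mul_of_nonneg_left ?_ (norm_nonneg _)
  refine (ContinuousLinearMap.le_opNorm _ _).trans_eq ?_
  rw [norm_ccLp_reflect, mul_comm]

variable {H : Type*} [NormedAddCommGroup H] [InnerProductSpace ℂ H] [CompleteSpace H]

/-- Every regular representation is bounded by `M ⋊ ρ`, since evaluations at the points of `G`
compute the norm of `C_b^{ru}(G)`. -/
theorem norm_regularRep_le_norm_MRho (π : Cbru G →⋆ₙₐ[ℂ] (H →L[ℂ] H)) (f : C_c(G, Cbru G)) :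
    ‖(regularRep actionR π μ).integratedForm μ f‖ ≤ ‖(MRho μ).integratedForm μ f‖ := by
  refine CovariantRep.norm_integratedForm_le_of_dense (MRho μ) (regularRep actionR π μ) μ
    _ (dense_span_tensorLp μ) (fun ξ hξ => ?_) f
  suffices h : ∀ η ∈ Submodule.span ℂ {ξ : Lp H 2 μ | ∃ φ h, ξ = tensorLp μ φ h},
      ∃ C : ℝ, ∀ f, ‖inner ℂ ξ ((regularRep actionR π μ).integratedForm μ f η)‖
        ≤ C * ‖(MRho μ).integratedForm μ f‖ from h ξ hξ
  intro η hη
  induction hξ, hη using Submodule.span_induction₂ with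
  | mem_mem ξ η hξ hη =>
    obtain ⟨ψ, k, rfl⟩ := hξ
    obtain ⟨φ, h, rfl⟩ := hη
    refine ⟨‖k‖ * ‖h‖ * (‖ccLp μ ψ‖ * ‖ccLp μ φ‖), fun f => ?_⟩
    rw [inner_regularRep_tensorLp]
    calc _ ≤ ‖k‖ * (‖π (coefficient actionR μ φ ψ f)‖ * ‖h‖) :=
          (norm_inner_le_norm _ _).trans (mul_le_mul_of_nonneg_left
            (ContinuousLinearMap.le_opNorm _ _) (norm_nonneg _))
      _ ≤ ‖k‖ * ((‖ccLp μ ψ‖ * ‖ccLp μ φ‖ * ‖(MRho μ).integratedForm μ f‖) * ‖h‖) := by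
          gcongr
          exact (NonUnitalStarAlgHom.norm_apply_le π _).trans (norm_coefficient_le μ φ ψ f)
      _ = _ := by ring
  | zero_left η hη => exact ⟨0, fun f => by simp⟩
  | zero_right ξ hξ => exact ⟨0, fun f => by simp⟩
  | add_left ξ₁ ξ₂ η _ _ _ h1 h2 =>
    obtain ⟨C, hC⟩ := h1
    obtain ⟨C', hC'⟩ := h2
    refine ⟨C + C', fun f => ?_⟩
    rw [inner_add_left, add_mul]
    exact (norm_add_le _ _).trans (add_le_add (hC f) (hC' f))
  | add_right ξ η₁ η₂ _ _ _ h1 h2 =>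
    obtain ⟨C, hC⟩ := h1
    obtain ⟨C', hC'⟩ := h2
    refine ⟨C + C', fun f => ?_⟩
    rw [map_add, inner_add_right, add_mul]
    exact (norm_add_le _ _).trans (add_le_add (hC f) (hC' f))
  | smul_left z ξ η _ _ h1 =>
    obtain ⟨C, hC⟩ := h1
    refine ⟨‖z‖ * C, fun f => ?_⟩
    rw [inner_smul_left, norm_mul, RCLike.norm_conj, mul_assoc]
    exact mul_le_mul_of_nonneg_left (hC f) (norm_nonneg _)
  | smul_right z ξ η _ _ h1 =>
    obtain ⟨C, hC⟩ := h1
    refine ⟨‖z‖ * C, fun f => ?_⟩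
    rw [map_smul, inner_smul_right, norm_mul, mul_assoc]
    exact mul_le_mul_of_nonneg_left (hC f) (norm_nonneg _)

/-- A faithful representation of the coefficients is isometric on the coefficients of `f`, and
their values at the identity of `G` exhaust the sesquilinear form of `M ⋊ ρ`. -/
theorem norm_MRho_le_norm_regularRep (π : Cbru G →⋆ₙₐ[ℂ] (H →L[ℂ] H))
    (hπ : Function.Injective π) (f : C_c(G, Cbru G)) :
    ‖(MRho μ).integratedForm μ f‖ ≤ ‖(regularRep actionR π μ).integratedForm μ f‖ := by
  set C := ‖(regularRep actionR π μ).integratedForm μ f‖ with hC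
  refine opNorm_le_of_inner_ccLp μ _ (norm_nonneg _) fun φ ψ => ?_
  have h1 : ‖coefficient actionR μ (reflect 1 φ) (reflect 1 ψ) f‖
      ≤ C * ‖ccLp μ φ‖ * ‖ccLp μ ψ‖ := by
    rw [← NonUnitalStarAlgHom.norm_map π hπ]
    refine ContinuousLinearMap.opNorm_le_bound _ (by positivity) fun h => ?_
    set T := π (coefficient actionR μ (reflect 1 φ) (reflect 1 ψ) f) with hT
    have h2 : ‖inner ℂ (T h) (T h)‖ ≤ C * ‖ccLp μ φ‖ * ‖ccLp μ ψ‖ * ‖h‖ * ‖T h‖ := by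
      nth_rewrite 2 [hT]
      rw [← inner_regularRep_tensorLp]
      refine (norm_inner_le_norm _ _).trans ?_
      have h3 := norm_tensorLp_le μ (reflect 1 ψ) (T h)
      have h4 := norm_tensorLp_le μ (reflect 1 φ) h
      rw [norm_ccLp_reflect] at h3 h4
      calc _ ≤ ‖ccLp μ ψ‖ * ‖T h‖ * (C * (‖ccLp μ φ‖ * ‖h‖)) :=
            mul_le_mul h3 ((ContinuousLinearMap.le_opNorm _ _).trans
              (mul_le_mul_of_nonneg_left h4 (norm_nonneg _))) (norm_nonneg _) (by positivity)
        _ = _ := by ring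
    rw [inner_self_eq_norm_sq_to_K] at h2
    rcases eq_or_lt_of_le (norm_nonneg (T h)) with h0 | hpos
    · rw [← h0]; positivity
    · have h3 : ‖T h‖ * ‖T h‖ ≤ C * ‖ccLp μ φ‖ * ‖ccLp μ ψ‖ * ‖h‖ * ‖T h‖ := by
        simpa [sq] using h2
      exact le_of_mul_le_mul_right h3 hpos
  have h2 := coefficient_apply μ (reflect 1 φ) (reflect 1 ψ) f 1
  rw [reflect_one_reflect_one, reflect_one_reflect_one] at h2
  rw [← h2]
  exact ((coefficient actionR μ (reflect 1 φ) (reflect 1 ψ) f).1.norm_coe_le_norm 1).trans h1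

end Evaluation
end Main

/-! ### Vectors of `ℓ²(Z)` and matrix coefficients -/

section EllTwo
variable {Z : Type*}

theorem basisVec_apply_self (z : Z) : (basisVec z : EllTwo Z) z = 1 := by
  classical
  simp [basisVec]

theorem basisVec_apply_of_ne {z w : Z} (h : w ≠ z) : (basisVec z : EllTwo Z) w = 0 := by
  classical
  rw [basisVec, lp.single_apply_ne _ _ _ h]

theorem norm_basisVec (z : Z) : ‖(basisVec z : EllTwo Z)‖ = 1 := by
  classical
  rw [basisVec, lp.norm_single (by norm_num), norm_one]

theorem norm_apply_le_norm (u : EllTwo Z) (z : Z) : ‖u z‖ ≤ ‖u‖ := by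
  rw [← inner_basisVec]
  refine (norm_inner_le_norm _ _).trans_eq ?_
  rw [norm_basisVec, one_mul]

theorem eq_sum_basisVec (u : EllTwo Z) (F : Finset Z) (hu : ∀ z ∉ F, u z = 0) :
    u = ∑ z ∈ F, u z • basisVec z := by
  ext z
  rw [← inner_basisVec, ← inner_basisVec, inner_sum]
  simp only [inner_smul_right, inner_basisVec]
  by_cases hz : z ∈ F
  · rw [Finset.sum_eq_single_of_mem z hz fun w _ hw => by
      rw [basisVec_apply_of_ne hw.symm, mul_zero], basisVec_apply_self, mul_one]
  · rw [hu z hz, Finset.sum_eq_zero fun w hw => ?_]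
    rw [basisVec_apply_of_ne fun h => hz (by rw [h]; exact hw), mul_zero]

theorem norm_inner_le_of_matrixCoeff_le (T : EllTwo Z →L[ℂ] EllTwo Z) (u w : EllTwo Z)
    (F : Finset Z) (hu : ∀ z ∉ F, u z = 0) (hw : ∀ z ∉ F, w z = 0) {ε : ℝ}
    (hT : ∀ x ∈ F, ∀ y ∈ F, ‖matrixCoeff T x y‖ ≤ ε) :
    ‖inner ℂ w (T u)‖ ≤ F.card * (F.card * (‖w‖ * ‖u‖ * ε)) := by
  have e : inner ℂ w (T u)
      = ∑ x ∈ F, ∑ y ∈ F, (starRingEnd ℂ) (w x) * (u y * matrixCoeff T x y) := by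
    conv_lhs => rw [eq_sum_basisVec u F hu, eq_sum_basisVec w F hw]
    simp only [map_sum, map_smul, sum_inner, inner_sum, inner_smul_left, inner_smul_right,
      matrixCoeff, Finset.mul_sum]
    rw [Finset.sum_comm]
    exact Finset.sum_congr rfl fun x _ => Finset.sum_congr rfl fun y _ => by ring
  rw [e, ← nsmul_eq_mul]
  refine (norm_sum_le _ _).trans (Finset.sum_le_card_nsmul _ _ _ fun x hx => ?_)
  rw [← nsmul_eq_mul]
  refine (norm_sum_le _ _).trans (Finset.sum_le_card_nsmul _ _ _ fun y hy => ?_)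
  rw [norm_mul, norm_mul, RCLike.norm_conj, mul_assoc]
  exact mul_le_mul (norm_apply_le_norm w x) (mul_le_mul (norm_apply_le_norm u y) (hT x hx y hy)
    (norm_nonneg _) (norm_nonneg _)) (by positivity) (norm_nonneg _)

end EllTwo

section Embedding
variable {G : Type*} [Group G] [MetricSpace G] [ProperSpace G] [IsTopologicalGroup G]
  [IsIsometricSMul G G] [MeasurableSpace G] [BorelSpace G]

theorem dist_mul_left_eq (g x y : G) : dist (g * x) (g * y) = dist x y := dist_smul g x y

namespace LatticeBump
variable {μ : Measure G} [μ.IsHaarMeasure] {Z : Set G} (b : LatticeBump μ Z)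

/-! ### The sampling map `x ↦ ∑_z φ_z(x) δ_z` -/

theorem dist_le_of_ne_zero {u x : G} (hu : b.φ (u⁻¹ * x) ≠ 0) : dist x u ≤ b.δ / 4 := by
  have := b.φ_support (subset_tsupport _ hu)
  rw [Metric.mem_closedBall] at this
  rw [← dist_mul_left_eq u⁻¹]
  simpa using this

theorem eq_of_ne_zero {x : G} {z w : Z} (hz : b.φ ((z : G)⁻¹ * x) ≠ 0)
    (hw : b.φ ((w : G)⁻¹ * x) ≠ 0) : z = w := by
  by_contra h
  have h2 := b.separated z z.2 w w.2 fun h' => h (Subtype.ext h')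
  have h3 := dist_triangle_left (z : G) (w : G) x
  linarith [b.dist_le_of_ne_zero hz, b.dist_le_of_ne_zero hw, b.δ_pos]

open Classical in
/-- The vector `∑_z φ_z(x) δ_z` of `ℓ²(Z)`. The supports of the `φ_z` are disjoint, so at most
one summand is nonzero. -/
def sample (x : G) : EllTwo Z :=
  if h : ∃ z : Z, b.φ ((z : G)⁻¹ * x) ≠ 0 then
    (b.φ ((h.choose : G)⁻¹ * x) : ℂ) • basisVec h.choose
  else 0

theorem sample_of_ne_zero {x : G} {z : Z} (hz : b.φ ((z : G)⁻¹ * x) ≠ 0) :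
    b.sample x = (b.φ ((z : G)⁻¹ * x) : ℂ) • basisVec z := by
  have h : ∃ z : Z, b.φ ((z : G)⁻¹ * x) ≠ 0 := ⟨z, hz⟩
  rw [sample, dif_pos h, b.eq_of_ne_zero h.choose_spec hz]

theorem sample_of_forall {x : G} (h : ∀ z : Z, b.φ ((z : G)⁻¹ * x) = 0) : b.sample x = 0 := by
  rw [sample, dif_neg (by push Not; exact h)]

theorem sample_apply (x : G) (z : Z) : b.sample x z = b.φ ((z : G)⁻¹ * x) := by
  by_cases h : ∃ w : Z, b.φ ((w : G)⁻¹ * x) ≠ 0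
  · obtain ⟨w, hw⟩ := h
    rw [b.sample_of_ne_zero hw, lp.coeFn_smul, Pi.smul_apply, smul_eq_mul]
    by_cases hz : z = w
    · rw [hz, basisVec_apply_self, mul_one]
    · rw [basisVec_apply_of_ne hz, mul_zero]
      by_contra hne
      exact hz (b.eq_of_ne_zero (fun h0 => hne (by simp [h0])) hw)
  · push Not at h
    rw [b.sample_of_forall h, h z]
    simp

theorem exists_sample_eq {x : G} (h : b.sample x ≠ 0) :
    ∃ z : Z, dist x z ≤ b.δ / 4 ∧ b.sample x = (b.φ ((z : G)⁻¹ * x) : ℂ) • basisVec z := by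
  obtain ⟨z, hz⟩ : ∃ z : Z, b.φ ((z : G)⁻¹ * x) ≠ 0 := by
    by_contra hcon
    push Not at hcon
    exact h (b.sample_of_forall hcon)
  exact ⟨z, b.dist_le_of_ne_zero hz, b.sample_of_ne_zero hz⟩

theorem exists_norm_sample_le : ∃ M : ℝ, 0 ≤ M ∧ ∀ x, ‖b.sample x‖ ≤ M := by
  obtain ⟨M, hM⟩ := b.φ.hasCompactSupport.exists_bound_of_continuous b.φ.continuous
  have hM0 : 0 ≤ M := (norm_nonneg _).trans (hM 1)
  refine ⟨M, hM0, fun x => ?_⟩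
  by_cases h : b.sample x = 0
  · rw [h, norm_zero]; exact hM0
  · obtain ⟨z, -, hz⟩ := b.exists_sample_eq h
    rw [hz, norm_smul, norm_basisVec, mul_one, Complex.norm_real]
    exact hM _

/-- The vectors `v(x)` and `v(y)` have at most two nonzero coordinates in total, whence the
factor `2`. -/
theorem norm_sample_sub_le {x y : G} {ε : ℝ} (h : ∀ z : Z,
    |b.φ ((z : G)⁻¹ * x) - b.φ ((z : G)⁻¹ * y)| ≤ ε) (hε : 0 ≤ ε) :
    ‖b.sample x - b.sample y‖ ≤ 2 * ε := by
  have key : ∀ (r : ℝ) (z : Z), ‖(r : ℂ) • (basisVec z : EllTwo Z)‖ = |r| := fun r z => by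
    rw [norm_smul, norm_basisVec, mul_one, Complex.norm_real, Real.norm_eq_abs]
  have hzero : ∀ {x : G} {z w : Z}, b.φ ((z : G)⁻¹ * x) ≠ 0 → z ≠ w →
      b.φ ((w : G)⁻¹ * x) = 0 := fun hz hne => by
    by_contra h0
    exact hne (b.eq_of_ne_zero hz h0)
  by_cases hx : ∃ z : Z, b.φ ((z : G)⁻¹ * x) ≠ 0
  · obtain ⟨z, hz⟩ := hx
    by_cases hy : ∃ w : Z, b.φ ((w : G)⁻¹ * y) ≠ 0
    · obtain ⟨w, hw⟩ := hy
      rw [b.sample_of_ne_zero hz, b.sample_of_ne_zero hw]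
      by_cases hzw : z = w
      · subst hzw
        rw [← sub_smul, ← Complex.ofReal_sub, key]
        linarith [h z]
      · refine (norm_sub_le _ _).trans ?_
        rw [key, key]
        have h1 := h z
        have h2 := h w
        rw [hzero hw (Ne.symm hzw), sub_zero] at h1
        rw [hzero hz hzw, zero_sub, abs_neg] at h2
        linarith
    · push Not at hy
      rw [b.sample_of_ne_zero hz, b.sample_of_forall hy, sub_zero, key]
      have h1 := h z
      rw [hy, sub_zero] at h1
      linarith
  · push Not at hx
    rw [b.sample_of_forall hx, zero_sub, norm_neg]
    by_cases hy : ∃ w : Z, b.φ ((w : G)⁻¹ * y) ≠ 0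
    · obtain ⟨w, hw⟩ := hy
      rw [b.sample_of_ne_zero hw, key]
      have h2 := h w
      rw [hx, zero_sub, abs_neg] at h2
      linarith
    · push Not at hy
      rw [b.sample_of_forall hy, norm_zero]
      linarith

/-- Left invariance of the metric makes the functions `φ_z` equicontinuous. -/
theorem uniformContinuous_sample : UniformContinuous b.sample := by
  have hu : UniformContinuous b.φ :=
    b.φ.hasCompactSupport.uniformContinuous_of_continuous b.φ.continuous
  rw [Metric.uniformContinuous_iff] at hu ⊢
  intro ε hε
  obtain ⟨η, hη, h⟩ := hu (ε / 4) (by positivity)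
  refine ⟨η, hη, fun {x y} hxy => ?_⟩
  rw [dist_eq_norm]
  refine (b.norm_sample_sub_le (ε := ε / 4) (fun z => ?_) (by positivity)).trans_lt (by linarith)
  have := h (a := (z : G)⁻¹ * x) (b := (z : G)⁻¹ * y) (by rwa [dist_mul_left_eq])
  exact this.le

/-- The adjoint of `W` is integration against the sampling map. -/
theorem adjoint_W_ccLp (φ : C_c(G, ℂ)) :
    ContinuousLinearMap.adjoint b.W.toContinuousLinearMap (ccLp μ φ)
      = ∫ y, φ y • b.sample y ∂μ := by
  have hi : Integrable (fun y => φ y • b.sample y) μ :=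
    (φ.continuous.smul b.uniformContinuous_sample.continuous).integrable_of_hasCompactSupport
      φ.hasCompactSupport.smul_right
  ext z
  rw [← inner_basisVec, ← inner_basisVec, ← integral_inner hi,
    ContinuousLinearMap.adjoint_inner_right]
  change inner ℂ (b.W (basisVec z)) _ = _
  rw [W_basisVec, L2.inner_def]
  refine integral_congr_ae ?_
  filter_upwards [ccLp_ae μ φ, (b.memLp_translate (z : G)).coeFn_toLp] with y h1 h2
  rw [translate, h1, h2, RCLike.inner_apply, Complex.conj_ofReal, inner_smul_right, inner_basisVec,
    sample_apply]

/-! ### Finite propagation operators in the image of `M ⋊ ρ` -/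

theorem norm_inner_sample_sub_le (T : EllTwo Z →L[ℂ] EllTwo Z) {M : ℝ}
    (hM : ∀ x, ‖b.sample x‖ ≤ M) (x y x' y' : G) :
    ‖inner ℂ (b.sample x) (T (b.sample y)) - inner ℂ (b.sample x') (T (b.sample y'))‖
      ≤ ‖T‖ * M * (‖b.sample x - b.sample x'‖ + ‖b.sample y - b.sample y'‖) := by
  have hM0 : 0 ≤ M := (norm_nonneg _).trans (hM 1)
  have e : inner ℂ (b.sample x) (T (b.sample y)) - inner ℂ (b.sample x') (T (b.sample y'))
      = inner ℂ (b.sample x - b.sample x') (T (b.sample y))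
        + inner ℂ (b.sample x') (T (b.sample y - b.sample y')) := by
    rw [inner_sub_left, map_sub, inner_sub_right]
    ring
  rw [e]
  calc _ ≤ ‖b.sample x - b.sample x'‖ * (‖T‖ * M)
        + M * (‖T‖ * ‖b.sample y - b.sample y'‖) := by
        refine (norm_add_le _ _).trans (add_le_add ?_ ?_)
        · refine (norm_inner_le_norm _ _).trans (mul_le_mul_of_nonneg_left ?_ (norm_nonneg _))
          exact (T.le_opNorm _).trans (mul_le_mul_of_nonneg_left (hM y) (norm_nonneg _))
        · exact (norm_inner_le_norm _ _).trans
            (mul_le_mul (hM x') (T.le_opNorm _) (norm_nonneg _) hM0)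
    _ = _ := by ring

/-- The function `x ↦ ⟨v(x), T v(x s)⟩` for the sampling map `v`, i.e. the kernel of `W T W^*`
restricted to the `s`-th diagonal of `G × G`. -/
def diagonal (T : EllTwo Z →L[ℂ] EllTwo Z) (s : G) : Cbru G :=
  ⟨BoundedContinuousFunction.ofNormedAddCommGroup
    (fun x => inner ℂ (b.sample x) (T (b.sample (x * s))))
    (b.uniformContinuous_sample.continuous.inner
      (T.continuous.comp (b.uniformContinuous_sample.continuous.comp (continuous_mul_const s))))
    (b.exists_norm_sample_le.choose * (‖T‖ * b.exists_norm_sample_le.choose))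
    (fun x => (norm_inner_le_norm _ _).trans (mul_le_mul (b.exists_norm_sample_le.choose_spec.2 x)
      ((T.le_opNorm _).trans (mul_le_mul_of_nonneg_left
        (b.exists_norm_sample_le.choose_spec.2 _) (norm_nonneg _))) (norm_nonneg _)
      b.exists_norm_sample_le.choose_spec.1)), by
    obtain ⟨M, hM0, hM⟩ := b.exists_norm_sample_le
    intro ε hε
    obtain ⟨η, hη, h⟩ := Metric.uniformContinuous_iff.1 b.uniformContinuous_sample
      (ε / (2 * (‖T‖ * M + 1))) (by positivity)
    have h1 : ∀ᶠ g in 𝓝 (1 : G), dist g 1 < η := Metric.ball_mem_nhds _ hη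
    have h2 : ∀ᶠ g in 𝓝 (1 : G), dist (g * s) s < η := by
      have hc : Tendsto (fun g : G => g * s) (𝓝 1) (𝓝 s) := by
        simpa using (continuous_mul_const s).tendsto (1 : G)
      exact hc (Metric.ball_mem_nhds _ hη)
    filter_upwards [h1, h2] with g hg1 hg2 x
    have h3 := h (a := x * g) (b := x) (by
      calc dist (x * g) x = dist (x * g) (x * 1) := by rw [mul_one]
        _ < η := by rwa [dist_mul_left_eq])
    have h4 := h (a := x * g * s) (b := x * s) (by rwa [mul_assoc, dist_mul_left_eq])
    rw [dist_eq_norm] at h3 h4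
    refine (b.norm_inner_sample_sub_le T hM _ _ _ _).trans_lt ?_
    have h5 : ‖T‖ * M * (‖b.sample (x * g) - b.sample x‖
        + ‖b.sample (x * g * s) - b.sample (x * s)‖)
        ≤ ‖T‖ * M * (ε / (‖T‖ * M + 1)) := by
      refine mul_le_mul_of_nonneg_left ?_ (by positivity)
      have : ε / (‖T‖ * M + 1) = 2 * (ε / (2 * (‖T‖ * M + 1))) := by field_simp
      linarith
    refine h5.trans_lt ?_
    rw [mul_div_assoc', div_lt_iff₀ (by positivity)]
    nlinarith⟩

theorem diagonal_apply (T : EllTwo Z →L[ℂ] EllTwo Z) (s x : G) :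
    (b.diagonal T s).1 x = inner ℂ (b.sample x) (T (b.sample (x * s))) := rfl

theorem continuous_diagonal (T : EllTwo Z →L[ℂ] EllTwo Z) : Continuous (b.diagonal T) := by
  obtain ⟨M, hM0, hM⟩ := b.exists_norm_sample_le
  rw [Metric.continuous_iff]
  intro s₀ ε hε
  obtain ⟨η, hη, h⟩ := Metric.uniformContinuous_iff.1 b.uniformContinuous_sample
    (ε / (‖T‖ * M + 1)) (by positivity)
  refine ⟨η, hη, fun s hs => ?_⟩
  rw [dist_eq_norm]
  have h5 : ‖b.diagonal T s - b.diagonal T s₀‖ ≤ ‖T‖ * M * (ε / (‖T‖ * M + 1)) := by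
    refine Cbru_norm_le (by positivity) fun x => ?_
    refine (b.norm_inner_sample_sub_le T hM x (x * s) x (x * s₀)).trans ?_
    refine mul_le_mul_of_nonneg_left ?_ (by positivity)
    rw [sub_self, norm_zero, zero_add, ← dist_eq_norm]
    exact (h (by rwa [dist_mul_left_eq])).le
  refine h5.trans_lt ?_
  rw [mul_div_assoc', div_lt_iff₀ (by positivity)]
  nlinarith

theorem diagonal_eq_zero (T : EllTwo Z →L[ℂ] EllTwo Z) {R : ℝ}
    (hR : ∀ x y : Z, matrixCoeff T x y ≠ 0 → dist x y ≤ R) {s : G}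
    (hs : s ∉ Metric.closedBall (1 : G) (R + b.δ / 2)) : b.diagonal T s = 0 := by
  refine Cbru_ext fun x => ?_
  rw [diagonal_apply]
  change _ = (0 : ℂ)
  by_contra hne
  have hx : b.sample x ≠ 0 := fun h => hne (by rw [h, inner_zero_left])
  have hy : b.sample (x * s) ≠ 0 := fun h => hne (by rw [h, map_zero, inner_zero_right])
  obtain ⟨z, hz, ez⟩ := b.exists_sample_eq hx
  obtain ⟨w, hw, ew⟩ := b.exists_sample_eq hy
  rw [ez, ew, map_smul, inner_smul_left, inner_smul_right] at hne
  have hzw : dist (z : G) w ≤ R := hR z w (right_ne_zero_of_mul (right_ne_zero_of_mul hne))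
  refine hs ?_
  rw [Metric.mem_closedBall]
  have e : dist s 1 = dist (x * s) x := by rw [← dist_mul_left_eq x, mul_one]
  have t1 := dist_triangle (x * s) (w : G) x
  have t2 := dist_triangle (w : G) (z : G) x
  rw [dist_comm (w : G) z, dist_comm (z : G) x] at t2
  linarith

/-- The element `s ↦ Δ(s)^{-1/2} ⟨v(·), T v(· s)⟩` of `C_c(G, C_b^{ru}(G))` associated with an
operator `T` of finite propagation. -/
def bandCc (T : EllTwo Z →L[ℂ] EllTwo Z) (hT : T ∈ finitePropagation Z) : C_c(G, Cbru G) where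
  toFun s := (((√(modularFn s))⁻¹ : ℝ) : ℂ) • b.diagonal T s
  continuous_toFun := by
    have h1 : Continuous fun s : G => (√(modularFn s))⁻¹ :=
      continuous_modularFn.sqrt.inv₀ fun s => (Real.sqrt_pos.2 (modularFn_pos s)).ne'
    exact (Complex.continuous_ofReal.comp h1).smul (b.continuous_diagonal T)
  hasCompactSupport' := by
    obtain ⟨R, hR⟩ := hT
    exact HasCompactSupport.intro (isCompact_closedBall (1 : G) (R + b.δ / 2)) fun s hs => by
      rw [b.diagonal_eq_zero T hR hs, smul_zero]

theorem inner_conj_apply (T : EllTwo Z →L[ℂ] EllTwo Z) (ξ η : Lp ℂ 2 μ) :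
    inner ℂ η (b.conj T ξ)
      = inner ℂ (ContinuousLinearMap.adjoint b.W.toContinuousLinearMap η)
          (T (ContinuousLinearMap.adjoint b.W.toContinuousLinearMap ξ)) :=
  (ContinuousLinearMap.adjoint_inner_left b.W.toContinuousLinearMap
    (T (ContinuousLinearMap.adjoint b.W.toContinuousLinearMap ξ)) η).symm

/-- For `T` of finite propagation `W T W^*` has the kernel `⟨v(x), T v(y)⟩`, and the substitution
`y = x s` turns the integral operator with this kernel into the integrated form of `bandCc`. -/
theorem conj_eq_integratedForm (T : EllTwo Z →L[ℂ] EllTwo Z) (hT : T ∈ finitePropagation Z) :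
    b.conj T = (MRho μ).integratedForm μ (b.bandCc T hT) := by
  have hv := b.uniformContinuous_sample.continuous
  refine eq_of_inner_ccLp μ fun φ ψ => ?_
  have hφ : Integrable (fun y => φ y • b.sample y) μ :=
    (φ.continuous.smul hv).integrable_of_hasCompactSupport φ.hasCompactSupport.smul_right
  have hψ : Integrable (fun y => ψ y • b.sample y) μ :=
    (ψ.continuous.smul hv).integrable_of_hasCompactSupport ψ.hasCompactSupport.smul_right
  have hTφ : Integrable (fun y => T (φ y • b.sample y)) μ := T.integrable_comp hφ
  have e1 : ∀ s x, (starRingEnd ℂ) (ψ x) * ((b.bandCc T hT s).1 x *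
      (((√(modularFn s) : ℝ) : ℂ) * φ (x * s)))
      = (starRingEnd ℂ) (ψ x) * inner ℂ (b.sample x) (T (φ (x * s) • b.sample (x * s))) := by
    intro s x
    have e : (b.bandCc T hT s).1 x
        = (((√(modularFn s))⁻¹ : ℝ) : ℂ) * inner ℂ (b.sample x) (T (b.sample (x * s))) := rfl
    have e2 : (((√(modularFn s))⁻¹ : ℝ) : ℂ) * ((√(modularFn s) : ℝ) : ℂ) = 1 := by
      rw [← Complex.ofReal_mul, inv_mul_cancel₀ (Real.sqrt_pos.2 (modularFn_pos s)).ne',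
        Complex.ofReal_one]
    rw [e, map_smul, inner_smul_right]
    linear_combination ((starRingEnd ℂ) (ψ x) * inner ℂ (b.sample x) (T (b.sample (x * s))) *
      φ (x * s)) * e2
  have hc : Continuous (Function.uncurry fun s x : G => (starRingEnd ℂ) (ψ x) *
      inner ℂ (b.sample x) (T (φ (x * s) • b.sample (x * s)))) := by
    have h1 : Continuous fun p : G × G => (starRingEnd ℂ) (ψ p.2) :=
      RCLike.continuous_conj.comp (ψ.continuous.comp continuous_snd)
    have hm : Continuous fun p : G × G => p.2 * p.1 := by fun_prop
    exact h1.mul ((hv.comp continuous_snd).inner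
      (T.continuous.comp ((φ.continuous.comp hm).smul (hv.comp hm))))
  have hcs : HasCompactSupport (Function.uncurry fun s x : G => (starRingEnd ℂ) (ψ x) *
      inner ℂ (b.sample x) (T (φ (x * s) • b.sample (x * s)))) := by
    refine HasCompactSupport.intro (K := ((tsupport ψ)⁻¹ * tsupport φ) ×ˢ tsupport ψ)
      ((ψ.hasCompactSupport.isCompact.inv.mul φ.hasCompactSupport.isCompact).prod
        ψ.hasCompactSupport.isCompact) ?_
    rintro ⟨s, x⟩ hsx
    by_contra hne
    have h1 : ψ x ≠ 0 := fun h => hne (by simp [h])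
    have h2 : φ (x * s) ≠ 0 := fun h => hne (by simp [h])
    exact hsx ⟨⟨x⁻¹, Set.inv_mem_inv.2 (subset_tsupport _ h1), x * s, subset_tsupport _ h2,
      by simp⟩, subset_tsupport _ h1⟩
  rw [inner_conj_apply, adjoint_W_ccLp, adjoint_W_ccLp, inner_MRho_ccLp]
  simp_rw [e1]
  rw [integral_integral_swap_of_hasCompactSupport hc hcs, ← T.integral_comp_comm hφ,
    ← inner_conj_symm, ← integral_inner hψ, ← integral_conj]
  refine integral_congr_ae (Eventually.of_forall fun x => ?_)
  simp only [inner_smul_right, map_mul, inner_conj_symm]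
  rw [integral_const_mul, ← integral_inner hTφ,
    ← integral_mul_left_eq_self (fun y => inner ℂ (b.sample x) (T (φ y • b.sample y))) x]

theorem continuous_conj : Continuous b.conj := by
  unfold conj
  fun_prop

/-- Conjugation with the isometry `W` as a *-homomorphism. -/
def conjHom : (EllTwo Z →L[ℂ] EllTwo Z) →⋆ₙₐ[ℂ] (Lp ℂ 2 μ →L[ℂ] Lp ℂ 2 μ) where
  toFun := b.conj
  map_smul' z T := by ext ξ : 1; simp [conj]
  map_zero' := by ext ξ : 1; simp [conj]
  map_add' S T := by ext ξ : 1; simp [conj]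
  map_mul' S T := by
    have h : ∀ u, ContinuousLinearMap.adjoint b.W.toContinuousLinearMap (b.W u) = u := fun u =>
      congrArg (fun T : EllTwo Z →L[ℂ] EllTwo Z => T u) b.W.adjoint_comp_self
    ext ξ : 1
    simp [conj, h]
  map_star' T := by
    simp [conj, ContinuousLinearMap.star_eq_adjoint, ContinuousLinearMap.adjoint_comp,
      ContinuousLinearMap.comp_assoc]

theorem conj_injective : Function.Injective b.conj := by
  have h : ∀ u, ContinuousLinearMap.adjoint b.W.toContinuousLinearMap (b.W u) = u := fun u =>
    congrArg (fun T : EllTwo Z →L[ℂ] EllTwo Z => T u) b.W.adjoint_comp_self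
  intro S T hST
  ext1 u
  have h1 := congrArg (fun S : Lp ℂ 2 μ →L[ℂ] Lp ℂ 2 μ => S (b.W u)) hST
  simp only [conj, ContinuousLinearMap.comp_apply, h] at h1
  exact b.W.injective h1

theorem conj_mem_crossedProduct {T : EllTwo Z →L[ℂ] EllTwo Z} (hT : T ∈ uniformRoe Z) :
    b.conj T ∈ (MRho μ).crossedProduct μ := by
  rw [CovariantRep.mem_crossedProduct_iff]
  refine map_mem_closure b.continuous_conj (show T ∈ closure (finitePropagation Z : Set _) from hT)
    fun S hS => ?_
  exact ⟨b.bandCc S hS, (b.conj_eq_integratedForm S hS).symm⟩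

/-- The embedding `T ↦ W T W^*` of `C*_u(Z)` into the C*-algebra generated by `M ⋊ ρ`. -/
def roeHom : uniformRoe Z →⋆ₙₐ[ℂ] (MRho μ).crossedProduct μ where
  toFun T := ⟨b.conjHom T, b.conj_mem_crossedProduct T.2⟩
  map_smul' z T := Subtype.ext (map_smul b.conjHom z (T : EllTwo Z →L[ℂ] EllTwo Z))
  map_zero' := Subtype.ext (map_zero b.conjHom)
  map_add' S T := Subtype.ext (map_add b.conjHom (S : EllTwo Z →L[ℂ] EllTwo Z) T)
  map_mul' S T := Subtype.ext (map_mul b.conjHom (S : EllTwo Z →L[ℂ] EllTwo Z) T)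
  map_star' T := Subtype.ext (map_star b.conjHom (T : EllTwo Z →L[ℂ] EllTwo Z))

theorem roeHom_injective : Function.Injective b.roeHom := fun _ _ hST =>
  Subtype.ext (b.conj_injective (congrArg Subtype.val hST))

/-! ### Ghosts vanish at infinity -/

theorem adjoint_W_apply_eq_zero (φ : C_c(G, ℂ)) (z : Z)
    (h : ∀ y, dist y (z : G) ≤ b.δ / 4 → φ y = 0) :
    ContinuousLinearMap.adjoint b.W.toContinuousLinearMap (ccLp μ φ) z = 0 := by
  rw [← inner_basisVec, ContinuousLinearMap.adjoint_inner_right]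
  change inner ℂ (b.W (basisVec z)) _ = _
  rw [W_basisVec, L2.inner_def]
  refine integral_eq_zero_of_ae ?_
  filter_upwards [ccLp_ae μ φ, (b.memLp_translate (z : G)).coeFn_toLp] with y h1 h2
  rw [translate, h1, h2, RCLike.inner_apply, Complex.conj_ofReal]
  by_cases h3 : b.φ ((z : G)⁻¹ * y) = 0
  · simp [h3]
  · simp [h y (b.dist_le_of_ne_zero h3)]

theorem norm_adjoint_W_le (ξ : Lp ℂ 2 μ) :
    ‖ContinuousLinearMap.adjoint b.W.toContinuousLinearMap ξ‖ ≤ ‖ξ‖ := by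
  refine (ContinuousLinearMap.le_opNorm _ _).trans ?_
  rw [LinearIsometryEquiv.norm_map]
  exact mul_le_of_le_one_left (norm_nonneg _) b.W.norm_toContinuousLinearMap_le

/-- Against vectors concentrated near `x`, only the boundedly many coefficients `T_{z,w}` with
`z`, `w` near `x` matter; for a ghost they tend to zero as `x → ∞`. -/
theorem tendsto_inner_conj_reflect (hfin : UniformlyLocallyFinite Z) (T : uniformRoe Z)
    (hT : T ∈ ghosts Z) (φ ψ : C_c(G, ℂ)) :
    Tendsto (fun x => inner ℂ (ccLp μ (reflect x ψ)) (b.conj T (ccLp μ (reflect x φ))))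
      (cocompact G) (𝓝 0) := by
  obtain ⟨r, hr⟩ := ((φ.hasCompactSupport.isCompact.union
    ψ.hasCompactSupport.isCompact).isBounded).subset_closedBall (1 : G)
  set ρ := max (r + b.δ / 4) 1 with hρ
  have hsupp : ∀ χ : C_c(G, ℂ), tsupport χ ⊆ Metric.closedBall 1 r → ∀ x (z : Z),
      z ∉ {z : Z | dist x (z : G) ≤ ρ} →
      ContinuousLinearMap.adjoint b.W.toContinuousLinearMap (ccLp μ (reflect x χ)) z = 0 := by
    intro χ hχ x z hz
    refine b.adjoint_W_apply_eq_zero _ z fun y hy => ?_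
    by_contra hne
    have h1 : χ (y⁻¹ * x) ≠ 0 := fun h => hne (by rw [reflect_apply, h, mul_zero])
    have h2 := hχ (subset_tsupport _ h1)
    rw [Metric.mem_closedBall, ← dist_mul_left_eq y, mul_inv_cancel_left, mul_one] at h2
    have h3 := dist_triangle x y (z : G)
    exact hz ((h3.trans (by linarith)).trans (le_max_left _ 1))
  -- the points of `Z` within `ρ` of `x` lie in a ball of radius `2ρ` about any one of them
  obtain ⟨N, hN⟩ := hfin (2 * ρ) (by positivity)
  have hcard : ∀ x : G, {z : Z | dist x (z : G) ≤ ρ}.encard ≤ N := by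
    intro x
    rcases Set.eq_empty_or_nonempty {z : Z | dist x (z : G) ≤ ρ} with h | ⟨z₀, hz₀⟩
    · rw [h]; simp
    · refine (Set.encard_le_encard fun z hz => ?_).trans (hN z₀)
      rw [Metric.mem_closedBall]
      have := dist_triangle_left (z : G) (z₀ : G) x
      have h1 : dist x (z : G) ≤ ρ := hz
      have h2 : dist x (z₀ : G) ≤ ρ := hz₀
      change dist (z : G) (z₀ : G) ≤ _
      linarith
  rw [Metric.tendsto_nhds]
  intro ε hε
  -- the summand `1` keeps `c` positive when `N` or one of the norms vanishes
  set c : ℝ := N * (N * (‖ccLp μ ψ‖ * ‖ccLp μ φ‖)) + 1 with hc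
  have hc0 : 0 < c := by positivity
  have hev : ∀ᶠ p : Z × Z in Bornology.cobounded Z ×ˢ Bornology.cobounded Z,
      ‖matrixCoeff (T : EllTwo Z →L[ℂ] EllTwo Z) p.1 p.2‖ < ε / c := by
    have := Metric.tendsto_nhds.1 hT (ε / c) (by positivity)
    simpa using this
  obtain ⟨P, hP, P', hP', h⟩ := Filter.eventually_prod_iff.1 hev
  have hbd : Bornology.IsBounded ((↑) '' {z : Z | P z ∧ P' z}ᶜ : Set G) := by
    rw [Bornology.isBounded_image_subtype_val, Bornology.isBounded_def, compl_compl]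
    exact hP.and hP'
  obtain ⟨R, hR⟩ := hbd.subset_closedBall (1 : G)
  filter_upwards [(isCompact_closedBall (1 : G) (ρ + R)).compl_mem_cocompact] with x hx
  have hgood : ∀ z : Z, dist x (z : G) ≤ ρ → P z ∧ P' z := by
    intro z hz
    by_contra hbad
    have h1 := Metric.mem_closedBall.1 (hR ⟨z, hbad, rfl⟩)
    have h2 := dist_triangle x (z : G) 1
    exact hx (Metric.mem_closedBall.2 (by linarith))
  have hfinite : {z : Z | dist x (z : G) ≤ ρ}.Finite := Set.finite_of_encard_le_coe (hcard x)
  set F := hfinite.toFinset with hF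
  have hmem : ∀ z, z ∉ F → z ∉ {z : Z | dist x (z : G) ≤ ρ} := fun z hz => by
    rwa [hF, Set.Finite.mem_toFinset] at hz
  have hFN : (F.card : ℝ) ≤ N := by
    have := hcard x
    rw [hfinite.encard_eq_coe_toFinset_card] at this
    exact_mod_cast this
  rw [dist_zero_right, inner_conj_apply]
  have hu := b.norm_adjoint_W_le (ccLp μ (reflect x φ))
  have hw := b.norm_adjoint_W_le (ccLp μ (reflect x ψ))
  rw [norm_ccLp_reflect] at hu hw
  have key := norm_inner_le_of_matrixCoeff_le (T : EllTwo Z →L[ℂ] EllTwo Z)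
    (ContinuousLinearMap.adjoint b.W.toContinuousLinearMap (ccLp μ (reflect x φ)))
    (ContinuousLinearMap.adjoint b.W.toContinuousLinearMap (ccLp μ (reflect x ψ))) F
    (fun z hz => hsupp φ (Set.subset_union_left.trans hr) x z (hmem z hz))
    (fun z hz => hsupp ψ (Set.subset_union_right.trans hr) x z (hmem z hz))
    (ε := ε / c) fun z hz w hw => by
      rw [hF, Set.Finite.mem_toFinset] at hz hw
      exact (h (hgood z hz).1 (hgood w hw).2).le
  refine key.trans_lt ?_
  calc _ ≤ N * (N * (‖ccLp μ ψ‖ * ‖ccLp μ φ‖ * (ε / c))) := by gcongr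
    _ = (c - 1) * (ε / c) := by rw [hc]; ring
    _ < c * (ε / c) := by
      have : 0 < ε / c := by positivity
      nlinarith
    _ = ε := by field_simp

end LatticeBump
end Embedding

/-! ### The map to the crossed product of the quotient -/

section Quotient
variable {G : Type*} [Group G] [TopologicalSpace G] [IsTopologicalGroup G]
  [LocallyCompactSpace G] [SecondCountableTopology G] [MeasurableSpace G] [BorelSpace G]
  (μ : Measure G) [μ.IsHaarMeasure] [μ.Regular]
  {K : Type*} [NormedAddCommGroup K] [InnerProductSpace ℂ K] [CompleteSpace K]
  (σ : CbruModC0 G →⋆ₙₐ[ℂ] (K →L[ℂ] K))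

/-- The composition of the integrated form over the quotient with `f ↦ f + C_0(G)` is the
integrated form of the regular representation induced by the pullback of `σ` to `C_b^{ru}(G)`. -/
theorem integratedForm_ccMap_quotientHom (f : C_c(G, Cbru G)) :
    (regularRep actionRQuot σ μ).integratedForm μ (ccMap quotientHom f)
      = (regularRep actionR (σ.comp quotientHom) μ).integratedForm μ f := by
  have h : ∀ a : Cbru G, orbitHom actionRQuot σ (quotientHom a)
      = orbitHom actionR (σ.comp quotientHom) a := fun a =>
    BoundedContinuousFunction.ext fun t => rfl
  ext ξ : 1
  rw [CovariantRep.integratedForm_apply, CovariantRep.integratedForm_apply]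
  refine integral_congr_ae (Eventually.of_forall fun s => ?_)
  change mulOp μ (orbitHom actionRQuot σ (quotientHom (f s))) _
    = mulOp μ (orbitHom actionR (σ.comp quotientHom) (f s)) _
  rw [h]
  rfl

/-- If `f ∈ C_c(G, C_b^{ru}(G))` is close to an operator `S` for which the functions
`x ↦ ⟨V_x ψ, S V_x φ⟩`, with `V_x` the reflections, vanish at infinity, then the coefficients of `f`
are close to `C_0(G)`, and so the image of `f` over the quotient is small. -/
theorem norm_inner_regularRep_quotient_le {S : Lp ℂ 2 μ →L[ℂ] Lp ℂ 2 μ} {φ ψ : C_c(G, ℂ)}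
    (hS : Tendsto (fun x => inner ℂ (ccLp μ (reflect x ψ)) (S (ccLp μ (reflect x φ))))
      (cocompact G) (𝓝 0)) {f : C_c(G, Cbru G)} {ε : ℝ} (hε : 0 < ε)
    (hf : ‖S - (MRho μ).integratedForm μ f‖ ≤ ε) (h k : K) :
    ‖inner ℂ (tensorLp μ ψ k) ((regularRep actionR (σ.comp quotientHom) μ).integratedForm μ f
      (tensorLp μ φ h))‖ ≤ ‖k‖ * (((‖ccLp μ ψ‖ * ‖ccLp μ φ‖ + 1) * ε) * ‖h‖) := by
  have h3 : ‖quotientHom (coefficient actionR μ φ ψ f)‖ ≤ (‖ccLp μ ψ‖ * ‖ccLp μ φ‖ + 1) * ε := by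
    refine norm_mk_le_of_eventually (by positivity) ?_
    filter_upwards [Metric.tendsto_nhds.1 hS ε hε] with x hx
    rw [dist_zero_right] at hx
    rw [coefficient_apply]
    have e : (MRho μ).integratedForm μ f (ccLp μ (reflect x φ))
        = S (ccLp μ (reflect x φ))
          - (S - (MRho μ).integratedForm μ f) (ccLp μ (reflect x φ)) := by
      rw [sub_apply, sub_sub_cancel]
    rw [e, inner_sub_right]
    have h4 : ‖inner ℂ (ccLp μ (reflect x ψ))
        ((S - (MRho μ).integratedForm μ f) (ccLp μ (reflect x φ)))‖
        ≤ ‖ccLp μ ψ‖ * (ε * ‖ccLp μ φ‖) := by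
      refine (norm_inner_le_norm _ _).trans ?_
      rw [norm_ccLp_reflect]
      refine mul_le_mul_of_nonneg_left ?_ (norm_nonneg _)
      refine (ContinuousLinearMap.le_opNorm _ _).trans ?_
      rw [norm_ccLp_reflect]
      exact mul_le_mul_of_nonneg_right hf (norm_nonneg _)
    refine (norm_sub_le _ _).trans ((add_le_add hx.le h4).trans_eq ?_)
    ring
  rw [inner_regularRep_tensorLp]
  refine (norm_inner_le_norm _ _).trans (mul_le_mul_of_nonneg_left ?_ (norm_nonneg _))
  refine (ContinuousLinearMap.le_opNorm _ _).trans
    (mul_le_mul_of_nonneg_right ?_ (norm_nonneg _))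
  exact (NonUnitalStarAlgHom.norm_apply_le σ _).trans h3

/-- If all the functions `x ↦ ⟨V_x ψ, S V_x φ⟩` vanish at infinity, then `S` is annihilated by any
contraction which extends the passage to the quotient. -/
theorem eq_zero_of_tendsto_inner_reflect
    {D : NonUnitalStarSubalgebra ℂ (Lp K 2 μ →L[ℂ] Lp K 2 μ)}
    (q : (MRho μ).crossedProduct μ →⋆ₙₐ[ℂ] D) (hq : ∀ x, ‖q x‖ ≤ ‖x‖)
    (hqf : ∀ f, (q ((MRho μ).ofCc μ f) : Lp K 2 μ →L[ℂ] Lp K 2 μ)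
      = (regularRep actionR (σ.comp quotientHom) μ).integratedForm μ f)
    (S : (MRho μ).crossedProduct μ)
    (hS : ∀ φ ψ : C_c(G, ℂ), Tendsto (fun x => inner ℂ (ccLp μ (reflect x ψ))
      ((S : Lp ℂ 2 μ →L[ℂ] Lp ℂ 2 μ) (ccLp μ (reflect x φ)))) (cocompact G) (𝓝 0)) :
    q S = 0 := by
  obtain ⟨Q, hQ⟩ : ∃ Q : Lp K 2 μ →L[ℂ] Lp K 2 μ, (q S : Lp K 2 μ →L[ℂ] Lp K 2 μ) = Q := ⟨_, rfl⟩
  refine Subtype.ext (hQ.trans (eq_zero_of_inner_tensorLp μ fun φ ψ h k => ?_))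
  have hbound : ∀ ε > 0, ‖inner ℂ (tensorLp μ ψ k) (Q (tensorLp μ φ h))‖
      ≤ (‖tensorLp μ ψ k‖ * ‖tensorLp μ φ h‖
        + ‖k‖ * ((‖ccLp μ ψ‖ * ‖ccLp μ φ‖ + 1) * ‖h‖)) * ε := by
    intro ε hε
    obtain ⟨f, hf⟩ := (Metric.denseRange_iff.1 ((MRho μ).denseRange_ofCc μ)) S ε hε
    rw [dist_eq_norm] at hf
    have h5 := norm_inner_regularRep_quotient_le μ σ (hS φ ψ) hε hf.le h k
    have h1 : ‖Q - (regularRep actionR (σ.comp quotientHom) μ).integratedForm μ f‖ ≤ ε := by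
      rw [← hqf, ← hQ]
      have h2 := hq (S - (MRho μ).ofCc μ f)
      rw [map_sub] at h2
      exact h2.trans hf.le
    generalize (regularRep actionR (σ.comp quotientHom) μ).integratedForm μ f = P at h1 h5
    have h6 : ‖inner ℂ (tensorLp μ ψ k) ((Q - P) (tensorLp μ φ h))‖
        ≤ ‖tensorLp μ ψ k‖ * (ε * ‖tensorLp μ φ h‖) :=
      (norm_inner_le_norm _ _).trans (mul_le_mul_of_nonneg_left
        ((ContinuousLinearMap.le_opNorm _ _).trans
          (mul_le_mul_of_nonneg_right h1 (norm_nonneg _))) (norm_nonneg _))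
    have e : Q (tensorLp μ φ h) = (Q - P) (tensorLp μ φ h) + P (tensorLp μ φ h) := by
      rw [sub_apply, sub_add_cancel]
    rw [e, inner_add_right]
    refine (norm_add_le _ _).trans ((add_le_add h6 h5).trans_eq ?_)
    ring
  have hlim : Tendsto (fun ε : ℝ => (‖tensorLp μ ψ k‖ * ‖tensorLp μ φ h‖
      + ‖k‖ * ((‖ccLp μ ψ‖ * ‖ccLp μ φ‖ + 1) * ‖h‖)) * ε) (𝓝[>] 0) (𝓝 0) :=
    tendsto_nhdsWithin_of_tendsto_nhds <| by
      simpa using (continuous_const_mul _).tendsto (0 : ℝ)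
  refine norm_le_zero_iff.1 (ge_of_tendsto hlim ?_)
  filter_upwards [self_mem_nhdsWithin] with ε hε
  exact hbound ε hε

/-- The passage to the quotient on the C*-algebra generated by `M ⋊ ρ`. It annihilates the
operators whose coefficients against reflected functions vanish at infinity. -/
theorem exists_quotientMap :
    ∃ q : (MRho μ).crossedProduct μ →⋆ₙₐ[ℂ] reducedCrossedProduct actionRQuot σ μ,
      (∀ f : C_c(G, Cbru G), q ((MRho μ).ofCc μ f)
        = (regularRep actionRQuot σ μ).ofCc μ (ccMap quotientHom f)) ∧
      ∀ S : (MRho μ).crossedProduct μ,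
        (∀ φ ψ : C_c(G, ℂ), Tendsto (fun x => inner ℂ (ccLp μ (reflect x ψ))
          ((S : Lp ℂ 2 μ →L[ℂ] Lp ℂ 2 μ) (ccLp μ (reflect x φ)))) (cocompact G) (𝓝 0)) →
        q S = 0 := by
  have hmem : ∀ f, (regularRep actionR (σ.comp quotientHom) μ).integratedForm μ f
      ∈ (regularRep actionRQuot σ μ).crossedProduct μ := fun f => by
    rw [← integratedForm_ccMap_quotientHom]
    exact (regularRep actionRQuot σ μ).integratedForm_mem_crossedProduct μ _
  obtain ⟨q, hq, hqn⟩ := (MRho μ).exists_starHom_of_norm_le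
    (regularRep actionR (σ.comp quotientHom) μ) μ ((regularRep actionRQuot σ μ).crossedProduct μ)
    ((regularRep actionRQuot σ μ).isClosed_crossedProduct μ) hmem
    (norm_regularRep_le_norm_MRho μ _)
  exact ⟨q, fun f => Subtype.ext ((hq f).trans (integratedForm_ccMap_quotientHom μ σ f).symm),
    fun S hS => eq_zero_of_tendsto_inner_reflect μ σ q hqn hq S hS⟩

end Quotient

end

set_option maxHeartbeats 1000000 in
theorem mainTheorem7
    {G : Type*} [Group G] [MetricSpace G] [IsTopologicalGroup G] [ProperSpace G]
    [IsIsometricSMul G G] [MeasurableSpace G] [BorelSpace G]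
    (μ : Measure G) [μ.IsHaarMeasure]
    (Z : Set G) (hZ : IsMetricLattice Z) (hfin : UniformlyLocallyFinite Z)
    (b : LatticeBump μ Z)
    {H : Type*} [NormedAddCommGroup H] [InnerProductSpace ℂ H] [CompleteSpace H]
    (π : Cbru G →⋆ₙₐ[ℂ] (H →L[ℂ] H)) (hπ : Function.Injective π)
    {K : Type*} [NormedAddCommGroup K] [InnerProductSpace ℂ K] [CompleteSpace K]
    (σ : CbruModC0 G →⋆ₙₐ[ℂ] (K →L[ℂ] K)) (hσ : Function.Injective σ) :
    -- the faithful representation `M ⋊_r ρ` of `C_b^{ru}(G) ⋊_{R,r} G` on `L²(G)`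
    ∃ j : reducedCrossedProduct actionR π μ →⋆ₙₐ[ℂ] (Lp ℂ 2 μ →L[ℂ] Lp ℂ 2 μ),
      Function.Injective j ∧
      (∀ f : C_c(G, Cbru G),
        j ((regularRep actionR π μ).ofCc μ f) = (MRho μ).integratedForm μ f) ∧
      -- the embedding `Φ(T) = (M ⋊_r ρ)⁻¹(W T W^*)`
      ∃ Φ : uniformRoe Z →⋆ₙₐ[ℂ] reducedCrossedProduct actionR π μ,
        Function.Injective Φ ∧
        (∀ T : uniformRoe Z, j (Φ T) = b.conj T) ∧
        -- the map `q_r` induced by the quotient map `C_b^{ru}(G) → C_b^{ru}(G) / C_0(G)`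
        ∃ q : reducedCrossedProduct actionR π μ →⋆ₙₐ[ℂ] reducedCrossedProduct actionRQuot σ μ,
          (∀ f : C_c(G, Cbru G),
            q ((regularRep actionR π μ).ofCc μ f)
              = (regularRep actionRQuot σ μ).ofCc μ (ccMap quotientHom f)) ∧
          ∀ T ∈ ghosts Z, q (Φ T) = 0 := by
  obtain ⟨j, i, hj, hij, hji⟩ := (regularRep actionR π μ).exists_inverse_starHoms_of_norm_eq
    (MRho μ) μ fun f =>
      le_antisymm (norm_MRho_le_norm_regularRep μ π hπ f) (norm_regularRep_le_norm_MRho μ π f)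
  obtain ⟨q, hq, hq0⟩ := exists_quotientMap μ σ
  have hjinj : Function.Injective j := Function.LeftInverse.injective hij
  have hiinj : Function.Injective i := Function.LeftInverse.injective hji
  refine ⟨(NonUnitalStarSubalgebraClass.subtype ((MRho μ).crossedProduct μ)).comp j, ?_, fun f => ?_, i.comp b.roeHom, ?_,
    fun T => ?_, q.comp j, fun f => ?_, fun T hT => ?_⟩
  · exact Subtype.val_injective.comp hjinj
  · rw [NonUnitalStarAlgHom.comp_apply, hj]
    rfl
  · exact hiinj.comp b.roeHom_injective
  · rw [NonUnitalStarAlgHom.comp_apply, NonUnitalStarAlgHom.comp_apply, hji]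
    rfl
  · rw [NonUnitalStarAlgHom.comp_apply, hj, hq]
  · rw [NonUnitalStarAlgHom.comp_apply, NonUnitalStarAlgHom.comp_apply, hji]
    exact hq0 _ (b.tendsto_inner_conj_reflect hfin T hT)
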